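/- **Theorem.** Let $I=[0,1)$, $a_n=\frac1{100n^3}$ $(n\ge 1)$ and $N=4$. Put $I_n=\big[4\sum_{k=1}^{n-1}a_k,\;4\sum_{k=1}^{n}a_k\big)$, let $I_n^{(1)}$ and $I_n^{(2)}$ be its left and right halves (of length $2a_n$), let $J=\big[4\sum_{k\ge1}a_k,\,1\big)$, and cut $J$ into $N$ half-open intervals $J_1,\dots,J_N$ of equal length. Let $v_n:I\to I_n^{(1)}$ and $w_n:I\to I_n^{(2)}$ be the maps that send $0$ to the left end point of their target and have derivatives $$v_n'(x)=a_n\big(1+2\cos^2(2\pi n^4x)\big),\qquad w_n'(x)=a_n\big(1+2\sin^2(2\pi n^4x)\big),$$ and let $T:I\to I$ be the map whose inverse branches are the maps $v_n,w_n$ $(n\ge1)$ and the increasing affine bijections $I\to J_j$ $(1\le j\le N)$. Let $\mathcal L f(x)=\sum_{T(y)=x} f(y)/T'(y)$, where $T'$ is the derivative from the right. Then: 1. $T$ is a well-defined uniformly expanding Markov map with (infinitely many) full branches: the intervals $I_n^{(1)},I_n^{(2)},J_j$ form a partition of $I$, each of them is the bijective image of $I$ under the corresponding inverse branch, these branches have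 the derivatives prescribed above (the constant $|J|/N$ for the affine ones), and there is $\kappa>1$ with $T'\ge\kappa$ on $I$. 2. $T$ preserves Lebesgue measure, and $\mathcal L$ is its transfer operator: for every integrable $f:I\to\mathbb C$ the function $\mathcal Lf$ is integrable, and $\int f\cdot g\circ T\,dx=\int \mathcal L f\cdot g\,dx$ for every bounded measurable $g:I\to\mathbb C$. 3. $\mathcal L$ acts as a bounded operator on the space $\mathrm{Lip}$ of Lipschitz functions $f:I\to\mathbb C$ with the norm $\|f\|_{\mathrm{Lip}}=\sup|f|+\sup_{x\ne y}|f(x)-f(y)|/|x-y|$, and it has a spectral gap there: its essential spectral radius (the supremum of $|z|$ over the $z\in\mathbb C$ for which $z-\mathcal L$ is not Fredholm) is at most $3/4$; $1$ is an eigenvalue of algebraic multiplicity one; there is no other eigenvalue of modulus $1$; and there is $r<1$ such that the spectrum of $\mathcal L$ is contained in $\{1\}\cup\{|z|\le r\}$. 4. For every $k\ge1$, $\mathcal L^k$ does not act continuously on the space of functions of bounded variation: there is no finite $C$ such that $\|\mathcal L^kf\|_{\mathcal{BV}}\le C\|f\|_{\mathcal{BV}}$ for all $f$ with $\|f\|_{\mathcal{BV}}<\infty$.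 This holds both for functions defined everywhere, with $\|f\|_{\mathcal{BV}}=\sup|f|+\mathrm{Var}(f)$, and for classes of functions modulo equality almost everywhere, with $\|f\|_{\mathcal{BV}}=\|f\|_{L^1}+\inf\{\mathrm{Var}(g): g=f\text{ a.e.}\}$. -/

import Mathlib

open MeasureTheory
open scoped ENNReal NNReal

noncomputable section

namespace LipGap

/-- The interval `I = [0,1)`; its measure is Lebesgue measure (the subtype measure `volume`). -/
abbrev I : Type := ↥(Set.Ico (0 : ℝ) 1)

instance : MeasureSpace I := Measure.Subtype.measureSpace

/-! ### The interval map -/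

/-- Labels of the inverse branches: the pairs `v n`, `w n` (`n ≥ 1`) and `N` affine ones. -/
inductive Branch (N : ℕ) : Type
  | v (n : ℕ+) : Branch N
  | w (n : ℕ+) : Branch N
  | affine (j : Fin N) : Branch N

/-- The left end point `4 ∑_{k=1}^{n-1} a_k` of the interval `I_n`. -/
def leftEnd (a : ℕ → ℝ) (n : ℕ) : ℝ := 4 * ∑ k ∈ Finset.Ico 1 n, a k

/-- The left end point `4 ∑_{k≥1} a_k` of the interval `J = [4 ∑ a_k, 1)`. -/
def leftEndJ (a : ℕ → ℝ) : ℝ := 4 * ∑' n : ℕ+, a n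

/-- The left end point of the image of a branch: `I_n` is cut into two halves, and `J` into `N`
intervals of the same length. -/
def left (a : ℕ → ℝ) (N : ℕ) : Branch N → ℝ
  | .v n => leftEnd a n
  | .w n => leftEnd a n + 2 * a n
  | .affine j => leftEndJ a + (j : ℕ) * ((1 - leftEndJ a) / N)

/-- The length of the image of a branch. -/
def length (a : ℕ → ℝ) (N : ℕ) : Branch N → ℝ
  | .v n => 2 * a n
  | .w n => 2 * a n
  | .affine _ => (1 - leftEndJ a) / N

/-- The image of a branch: `I_n^{(1)}` for `v n`, `I_n^{(2)}` for `w n`, and the `N` pieces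
of `J` for the affine branches. -/
def piece (a : ℕ → ℝ) (N : ℕ) (b : Branch N) : Set ℝ :=
  Set.Ico (left a N b) (left a N b + length a N b)

/-- The prescribed derivative of a branch. -/
def branchDeriv (a : ℕ → ℝ) (N : ℕ) : Branch N → ℝ → ℝ
  | .v n, x => a n * (1 + 2 * Real.cos (2 * Real.pi * (n : ℝ) ^ 4 * x) ^ 2)
  | .w n, x => a n * (1 + 2 * Real.sin (2 * Real.pi * (n : ℝ) ^ 4 * x) ^ 2)
  | .affine _, _ => (1 - leftEndJ a) / N

/-- The inverse branch with the prescribed derivative that starts at the left end of its image. -/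
def branch (a : ℕ → ℝ) (N : ℕ) (b : Branch N) (x : ℝ) : ℝ :=
  left a N b + ∫ t in (0 : ℝ)..x, branchDeriv a N b t

instance (N : ℕ) : Nonempty (Branch N × I) := ⟨(.v 1, ⟨0, by simp⟩)⟩

/-- The map `T`: if `y = branch b x` with `x ∈ I`, then `T y = x`. -/
def intervalMap (a : ℕ → ℝ) (N : ℕ) (y : I) : I :=
  (Function.invFun (fun p : Branch N × I => branch a N p.1 p.2) (y : ℝ)).2

/-- The derivative `T'(y)`, taken from the right (so that it makes sense at the left end points
of the intervals of the partition as well). -/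
def rightDeriv (T : I → I) (y : I) : ℝ :=
  derivWithin (Function.extend Subtype.val (fun z : I => (T z : ℝ)) 0) (Set.Ico (y : ℝ) 1) y

/-- The transfer operator `f ↦ (x ↦ ∑_{T y = x} f y / T'(y))`. -/
def transfer (T : I → I) (f : I → ℂ) (x : I) : ℂ :=
  ∑' y : {y : I // T y = x}, f y / (rightDeriv T y : ℂ)

/-! ### The Banach space of Lipschitz functions -/

/-- The linear space of complex Lipschitz functions on `I`. -/
def lipSubmodule : Submodule ℂ (I → ℂ) where
  carrier := {f | ∃ K : ℝ≥0, LipschitzWith K f}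
  add_mem' := by
    rintro f g ⟨K, hK⟩ ⟨K', hK'⟩
    exact ⟨K + K', hK.add hK'⟩
  zero_mem' := ⟨0, LipschitzWith.const 0⟩
  smul_mem' := by
    rintro c f ⟨K, hK⟩
    refine ⟨‖c‖₊ * K, LipschitzWith.of_dist_le_mul fun x y => ?_⟩
    have h := hK.dist_le_mul x y
    simp only [Pi.smul_apply, dist_eq_norm, ← smul_sub, norm_smul] at h ⊢
    calc ‖c‖ * ‖f x - f y‖ ≤ ‖c‖ * (K * dist x y) := by gcongr
      _ = _ := by push_cast; rw [mul_assoc]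

/-- The type of complex Lipschitz functions on `I`. -/
def Lip : Type := ↥lipSubmodule

instance : AddCommGroup Lip := inferInstanceAs (AddCommGroup ↥lipSubmodule)
instance : Module ℂ Lip := inferInstanceAs (Module ℂ ↥lipSubmodule)
instance : CoeFun Lip (fun _ => I → ℂ) := ⟨fun f => f.1⟩

/-- The best Lipschitz constant `sup |f x - f y| / |x - y|`. -/
def lipConst (f : I → ℂ) : ℝ := ⨆ p : I × I, ‖f p.1 - f p.2‖ / dist p.1 p.2

/-- The norm `sup |f| + Lip(f)`. -/
instance : Norm Lip := ⟨fun f => (⨆ x : I, ‖f x‖) + lipConst f⟩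

instance : Nonempty I := ⟨⟨0, by simp⟩⟩

lemma Lip.norm_def (f : Lip) : ‖f‖ = (⨆ x : I, ‖f x‖) + lipConst f := rfl

lemma Lip.add_apply (f g : Lip) (x : I) : (f + g) x = f x + g x := rfl

lemma Lip.smul_apply (c : ℂ) (f : Lip) (x : I) : (c • f) x = c * f x := rfl

lemma Lip.bddAbove_lip (f : Lip) :
    BddAbove (Set.range fun p : I × I => ‖f p.1 - f p.2‖ / dist p.1 p.2) := by
  obtain ⟨K, hK⟩ := f.2
  refine ⟨K, ?_⟩
  rintro _ ⟨p, rfl⟩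
  have h := hK.dist_le_mul p.1 p.2
  rw [dist_eq_norm] at h
  exact div_le_of_le_mul₀ dist_nonneg K.2 h

lemma Lip.bddAbove_sup (f : Lip) : BddAbove (Set.range fun x : I => ‖f x‖) := by
  obtain ⟨K, hK⟩ := f.2
  let z : I := ⟨0, by simp⟩
  refine ⟨‖f z‖ + K, ?_⟩
  rintro _ ⟨x, rfl⟩
  have h := hK.dist_le_mul x z
  have hx : dist x z ≤ 1 := by
    rw [Subtype.dist_eq, Real.dist_eq]
    have h0 := x.2.1
    have h1 := x.2.2
    rw [abs_le]
    constructor <;> simp [z] <;> linarith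
  rw [dist_eq_norm] at h
  have h2 : ‖f x‖ ≤ ‖f z‖ + ‖f x - f z‖ := by
    simpa using norm_add_le (f z) (f x - f z)
  have h3 : (K : ℝ) * dist x z ≤ K * 1 := by gcongr
  change ‖f x‖ ≤ _
  linarith

lemma Lip.core : NormedSpace.Core ℂ Lip where
  norm_nonneg f := add_nonneg (Real.iSup_nonneg fun _ => norm_nonneg _)
    (Real.iSup_nonneg fun _ => div_nonneg (norm_nonneg _) dist_nonneg)
  norm_smul c f := by
    simp only [Lip.norm_def, lipConst, Lip.smul_apply, ← mul_sub, norm_mul, mul_div_assoc]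
    rw [← Real.mul_iSup_of_nonneg (norm_nonneg c), ← Real.mul_iSup_of_nonneg (norm_nonneg c),
      mul_add]
  norm_triangle f g := by
    have h1 : (⨆ x : I, ‖(f + g) x‖) ≤ (⨆ x : I, ‖f x‖) + ⨆ x : I, ‖g x‖ :=
      ciSup_le fun x => (norm_add_le _ _).trans
        (add_le_add (le_ciSup f.bddAbove_sup x) (le_ciSup g.bddAbove_sup x))
    have h2 : lipConst ((f + g : Lip) : I → ℂ) ≤ lipConst f + lipConst g := by
      refine ciSup_le fun p => ?_
      refine le_trans ?_ (add_le_add (le_ciSup f.bddAbove_lip p) (le_ciSup g.bddAbove_lip p))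
      rw [← add_div]
      refine div_le_div_of_nonneg_right ?_ dist_nonneg
      have : (f + g) p.1 - (f + g) p.2 = (f p.1 - f p.2) + (g p.1 - g p.2) := by
        simp only [Lip.add_apply]; ring
      exact this ▸ norm_add_le _ _
    simp only [Lip.norm_def]
    linarith
  norm_eq_zero_iff f := by
    constructor
    · intro h
      have h2 : 0 ≤ lipConst f := Real.iSup_nonneg fun _ => div_nonneg (norm_nonneg _) dist_nonneg
      rw [Lip.norm_def] at h
      apply Subtype.ext
      funext x
      have h3 : ‖f x‖ ≤ ⨆ x : I, ‖f x‖ := le_ciSup f.bddAbove_sup x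
      have h4 := norm_nonneg (f x)
      exact norm_eq_zero.1 (by linarith)
    · rintro rfl
      have : ∀ x, (0 : Lip) x = 0 := fun _ => rfl
      simp [Lip.norm_def, lipConst, this]

instance : NormedAddCommGroup Lip := NormedAddCommGroup.ofCore Lip.core
instance : NormedSpace ℂ Lip := NormedSpace.ofCore Lip.core

/-! ### Essential spectrum -/

/-- The essential spectral radius of a bounded operator: the supremum of `|z|` over the essential
spectrum, i.e. over the `z` for which `z - A` is not a Fredholm operator. -/
def essSpectralRadius {E : Type*} [NormedAddCommGroup E] [NormedSpace ℂ E] (A : E →L[ℂ] E) :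
    ℝ≥0∞ :=
  ⨆ z ∈ {z : ℂ | ¬ (z • ContinuousLinearMap.id ℂ E - A).IsFredholm}, ‖z‖ₑ

/-! ### Bounded variation -/

/-- The norm `sup |f| + Var(f)` (infinite exactly when `f` is not of bounded variation). -/
def bvNorm (f : I → ℂ) : ℝ≥0∞ := (⨆ x : I, ‖f x‖ₑ) + eVariationOn f Set.univ

/-- The norm of the space of classes (modulo equality almost everywhere) of functions of bounded
variation: the `L¹` norm plus the least variation of a function that is almost everywhere equal
to `f` (infinite exactly when the class of `f` is not of bounded variation). -/
def essBVNorm (f : I → ℂ) : ℝ≥0∞ :=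
  (∫⁻ x : I, ‖f x‖ₑ) + ⨅ (g : I → ℂ) (_ : f =ᵐ[volume] g), eVariationOn g Set.univ

/-- The operator `P` maps the space of functions of finite norm `ν` continuously to itself. -/
def ActsContinuously (ν : (I → ℂ) → ℝ≥0∞) (P : (I → ℂ) → (I → ℂ)) : Prop :=
  ∃ C : ℝ≥0, ∀ f : I → ℂ, ν f < ∞ → ν (P f) ≤ C * ν f

end LipGap

end

open LipGap

/-!
Although `v n'` and `w n'` oscillate quickly, their sum is the constant `4 * a n` and their images
are adjacent. In `𝓛 f x - 𝓛 f y` the oscillations of the two densities therefore cancel up to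
the difference of `f` at two points at distance `O(a n)`, so the pair contributes only
`O(n ^ 4 * a n ^ 2)` times the Lipschitz constant of `f`. These contributions are summable with a
small sum, and `𝓛` contracts Lipschitz constants. Hence `𝓛` minus the projection to the mean has
geometrically decaying powers, which gives the spectral gap.

On functions of bounded variation no such cancellation takes place: the indicator of a cylinder,
obtained by iterating one affine branch after `v n`, has norm at most `3`, while `𝓛 ^ (k + 1)` maps
it to a multiple of `v n'`, whose variation `~ n ^ 4 * a n` is unbounded.
-/

namespace LipGap

open Filter Function Set Topology

section TsumIntegrable

variable {α ι E : Type*} [MeasurableSpace α] {μ : Measure α} [Countable ι]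
  [NormedAddCommGroup E] [CompleteSpace E]

lemma integrable_tsum_of_summable_integral_norm {F : ι → α → E} (hF : ∀ i, Integrable (F i) μ)
    (hs : Summable fun i => ∫ x, ‖F i x‖ ∂μ) : Integrable (fun x => ∑' i, F i x) μ := by
  have hfin : ∫⁻ x, ∑' i, ‖F i x‖ₑ ∂μ ≠ ∞ := by
    rw [lintegral_tsum fun i => (hF i).1.enorm]
    simp_rw [← ofReal_integral_norm_eq_lintegral_enorm (hF _)]
    exact hs.tsum_ofReal_ne_top
  have hsum : ∀ᵐ x ∂μ, Summable fun i => F i x := by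
    filter_upwards [ae_lt_top' (AEMeasurable.tsum fun i => (hF i).1.enorm) hfin] with x hx
    exact .of_norm (NNReal.summable_coe.2 (ENNReal.tsum_coe_ne_top_iff_summable.1 hx.ne))
  refine ⟨aestronglyMeasurable_of_tendsto_ae (atTop : Filter (Finset ι))
    (fun s => Finset.aestronglyMeasurable_fun_sum s fun i _ => (hF i).1) ?_,
    (lintegral_mono fun x => enorm_tsum_le_tsum_enorm).trans_lt hfin.lt_top⟩
  filter_upwards [hsum] with x hx using hx.hasSum

end TsumIntegrable

/-- The maps `φ i` are the inverse branches of a full-branched map `T`: they are injective with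
disjoint ranges covering the space, and `ρ i` is the Jacobian of `φ i` with respect to `μ`. -/
structure IsFullBranchSystem {X ι : Type*} [MeasurableSpace X] (μ : Measure X) (T : X → X)
    (φ : ι → X → X) (ρ : ι → X → ℝ≥0) : Prop where
  measurableEmbedding : ∀ i, MeasurableEmbedding (φ i)
  leftInverse : ∀ i, LeftInverse T (φ i)
  disjoint_range : Pairwise (Disjoint on fun i => range (φ i))
  iUnion_range : ⋃ i, range (φ i) = univ
  measurable_density : ∀ i, Measurable (ρ i)
  setLIntegral_density : ∀ i ⦃A⦄, MeasurableSet A → ∫⁻ x in A, ρ i x ∂μ = μ (φ i '' A)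

namespace IsFullBranchSystem

variable {X ι : Type*} [MeasurableSpace X] {μ : Measure X} {T : X → X} {φ : ι → X → X}
  {ρ : ι → X → ℝ≥0}

lemma tsum_fiber {E : Type*} [AddCommMonoid E] [TopologicalSpace E]
    (h : IsFullBranchSystem μ T φ ρ) (F : X → E) (x : X) :
    ∑' y : {y // T y = x}, F y = ∑' i, F (φ i x) := by
  let e (i : ι) : {y // T y = x} := ⟨φ i x, h.leftInverse i x⟩
  have he : Bijective e := by
    refine ⟨fun i j hij => by_contra fun hne => ?_, fun ⟨y, hy⟩ => ?_⟩
    · exact disjoint_left.1 (h.disjoint_range hne) (mem_range_self x)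
        ⟨x, (congrArg Subtype.val hij).symm⟩
    · obtain ⟨i, z, rfl⟩ := mem_iUnion.1 (h.iUnion_range ▸ mem_univ y)
      obtain rfl : z = x := (h.leftInverse i z).symm.trans hy
      exact ⟨i, rfl⟩
  exact ((Equiv.ofBijective e he).tsum_eq (F ·)).symm

lemma map_withDensity (h : IsFullBranchSystem μ T φ ρ) (i : ι) :
    (μ.withDensity (ρ i ·)).map (φ i) = μ.restrict (range (φ i)) := by
  have hφ := (h.measurableEmbedding i).measurable
  ext A hA
  rw [Measure.map_apply hφ hA, withDensity_apply _ (hφ hA), h.setLIntegral_density i (hφ hA),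
    image_preimage_eq_inter_range, Measure.restrict_apply hA]

variable {E : Type*} [NormedAddCommGroup E] [NormedSpace ℝ E] {f : X → E}

lemma integral_map_withDensity (h : IsFullBranchSystem μ T φ ρ) (f : X → E) (i : ι) :
    ∫ x, f x ∂(μ.withDensity (ρ i ·)).map (φ i) = ∫ x, ρ i x • f (φ i x) ∂μ := by
  rw [(h.measurableEmbedding i).integral_map,
    integral_withDensity_eq_integral_smul (h.measurable_density i)]

variable [Countable ι]

lemma sum_map_withDensity (h : IsFullBranchSystem μ T φ ρ) :
    Measure.sum (fun i => (μ.withDensity (ρ i ·)).map (φ i)) = μ := by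
  simp_rw [h.map_withDensity]
  rw [← Measure.restrict_iUnion h.disjoint_range
    fun i => (h.measurableEmbedding i).measurableSet_range, h.iUnion_range, Measure.restrict_univ]

lemma measurable (h : IsFullBranchSystem μ T φ ρ) : Measurable T := by
  intro A hA
  have hT : T ⁻¹' A = ⋃ i, φ i '' A := by
    rw [← inter_univ (T ⁻¹' A), ← h.iUnion_range, inter_iUnion]
    refine iUnion_congr fun i => ?_
    rw [← image_preimage_eq_inter_range, ← preimage_comp, (h.leftInverse i).comp_eq_id,
      preimage_id]
  rw [hT]
  exact .iUnion fun i => (h.measurableEmbedding i).measurableSet_image.2 hA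

lemma measurePreserving (h : IsFullBranchSystem μ T φ ρ) (hρ : ∀ x, ∑' i, (ρ i x : ℝ≥0∞) = 1) :
    MeasurePreserving T μ μ := by
  refine ⟨h.measurable, ?_⟩
  have hmap (i : ι) : ((μ.withDensity (ρ i ·)).map (φ i)).map T = μ.withDensity (ρ i ·) := by
    rw [Measure.map_map h.measurable (h.measurableEmbedding i).measurable,
      (h.leftInverse i).comp_eq_id, Measure.map_id]
  have hone : (∑' i, fun x => (ρ i x : ℝ≥0∞)) = fun _ => 1 := by
    funext x
    rw [tsum_apply (Pi.summable.2 fun _ => ENNReal.summable), hρ]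
  conv_lhs => rw [← h.sum_map_withDensity]
  rw [Measure.map_sum h.measurable.aemeasurable]
  simp_rw [hmap]
  rw [← withDensity_tsum fun i => (h.measurable_density i).coe_nnreal_ennreal, hone,
    withDensity_const, one_smul]

lemma integrable_branch (h : IsFullBranchSystem μ T φ ρ) (hf : Integrable f μ) (i : ι) :
    Integrable (fun x => ρ i x • f (φ i x)) μ := by
  rw [← integrable_withDensity_iff_integrable_smul (h.measurable_density i)]
  rw [← h.sum_map_withDensity] at hf
  exact ((h.measurableEmbedding i).integrable_map_iff).1 (hf.mono_measure (Measure.le_sum _ i))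

lemma hasSum_integral_branch (h : IsFullBranchSystem μ T φ ρ) (hf : Integrable f μ) :
    HasSum (fun i => ∫ x, ρ i x • f (φ i x) ∂μ) (∫ x, f x ∂μ) := by
  simp_rw [← h.integral_map_withDensity]
  rw [← h.sum_map_withDensity] at hf
  convert hasSum_integral_measure hf
  exact h.sum_map_withDensity.symm

lemma summable_integral_norm_branch (h : IsFullBranchSystem μ T φ ρ) (hf : Integrable f μ) :
    Summable fun i => ∫ x, ‖ρ i x • f (φ i x)‖ ∂μ := by
  simpa only [NNReal.smul_def, norm_smul, Real.norm_of_nonneg (NNReal.coe_nonneg _), smul_eq_mul]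
    using (h.hasSum_integral_branch hf.norm).summable

lemma integrable_tsum_branch [CompleteSpace E] (h : IsFullBranchSystem μ T φ ρ)
    (hf : Integrable f μ) : Integrable (fun x => ∑' i, ρ i x • f (φ i x)) μ :=
  integrable_tsum_of_summable_integral_norm (h.integrable_branch hf)
    (h.summable_integral_norm_branch hf)

lemma integral_tsum_branch (h : IsFullBranchSystem μ T φ ρ) (hf : Integrable f μ) :
    ∫ x, ∑' i, ρ i x • f (φ i x) ∂μ = ∫ x, f x ∂μ := by
  rw [← (hasSum_integral_of_summable_integral_norm (h.integrable_branch hf)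
    (h.summable_integral_norm_branch hf)).tsum_eq, (h.hasSum_integral_branch hf).tsum_eq]

lemma integral_mul_comp {𝕜 : Type*} [RCLike 𝕜] (h : IsFullBranchSystem μ T φ ρ) {f g : X → 𝕜}
    (hf : Integrable f μ) (hg : Measurable g) {C : ℝ} (hC : ∀ x, ‖g x‖ ≤ C) :
    ∫ x, f x * g (T x) ∂μ = ∫ x, (∑' i, ρ i x • f (φ i x)) * g x ∂μ := by
  have hfg : Integrable (fun x => f x * g (T x)) μ :=
    hf.mul_bdd (hg.comp h.measurable).aestronglyMeasurable (.of_forall fun x => hC (T x))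
  rw [← h.integral_tsum_branch hfg]
  congr 1
  funext x
  rw [← tsum_mul_right]
  simp only [h.leftInverse _ x, smul_mul_assoc]

end IsFullBranchSystem

section RankOnePerturbation

variable {𝕜 A : Type*} [Field 𝕜] [Ring A] [Algebra 𝕜 A]

lemma isUnit_one_sub_smul_of_isIdempotentElem {p : A} (hp : IsIdempotentElem p) {c : 𝕜}
    (hc : c ≠ 1) : IsUnit (1 - c • p) := by
  have hc' : 1 - c ≠ 0 := sub_ne_zero.2 hc.symm
  refine isUnit_iff_exists.2 ⟨1 + (c * (1 - c)⁻¹) • p, ?_, ?_⟩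
  all_goals
    simp only [mul_add, add_mul, mul_sub, sub_mul, mul_one, one_mul, smul_mul_smul_comm, hp.eq]
    match_scalars
    all_goals field_simp
    all_goals ring

lemma spectrum_subset_insert_one {l p : A} (hp : IsIdempotentElem p) (hlp : l * p = p) :
    spectrum 𝕜 l ⊆ insert 1 (spectrum 𝕜 (l - p)) := by
  intro z hz
  rw [mem_insert_iff, or_iff_not_imp_left]
  intro hz1 hunit
  obtain rfl | hz0 := eq_or_ne z 0
  · have hp0 : p = 0 := by
      have : (algebraMap 𝕜 A 0 - (l - p)) * p = 0 := by simp [sub_mul, hlp, hp.eq]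
      exact hunit.mul_right_eq_zero.1 this
    exact hz (by rwa [hp0, sub_zero] at hunit)
  · have hfactor : algebraMap 𝕜 A z - l = (algebraMap 𝕜 A z - (l - p)) * (1 - z⁻¹ • p) := by
      simp only [Algebra.algebraMap_eq_smul_one, sub_mul, mul_sub, mul_one, mul_smul_comm, hlp,
        hp.eq, smul_mul_assoc, one_mul]
      rw [sub_self, sub_zero, inv_smul_smul₀ hz0]
      abel
    refine hz ?_
    rw [spectrum.mem_resolventSet_iff, hfactor]
    exact hunit.mul (isUnit_one_sub_smul_of_isIdempotentElem hp (inv_ne_one.2 hz1))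

end RankOnePerturbation

section GeneralizedEigenspace

variable {R M : Type*} [CommRing R] [AddCommGroup M] [Module R M]

lemma maxGenEigenspace_one_eq_span {f : Module.End R M} {φ : M →ₗ[R] R} {e : M}
    (hφf : ∀ v, φ (f v) = φ v) (hfe : f e = e) (hfix : ∀ v, f v = v → v = φ v • e) :
    f.maxGenEigenspace 1 = Submodule.span R {e} := by
  refine le_antisymm (fun v hv => ?_) ?_
  · obtain ⟨k, hk⟩ := Module.End.mem_maxGenEigenspace _ _ _ |>.1 hv
    suffices h : v = φ v • e from Submodule.mem_span_singleton.2 ⟨φ v, h.symm⟩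
    clear hv
    induction k generalizing v with
    | zero =>
      obtain rfl : v = 0 := by simpa using hk
      simp
    | succ k ih =>
      rw [pow_succ, Module.End.mul_apply] at hk
      have hsub := ih _ hk
      simp only [one_smul, LinearMap.sub_apply, Module.End.one_apply, map_sub, hφf, sub_self,
        zero_smul] at hsub
      exact hfix v (sub_eq_zero.1 hsub)
  · rw [Submodule.span_singleton_le_iff_mem, Module.End.mem_maxGenEigenspace]
    exact ⟨1, by simp [hfe]⟩

end GeneralizedEigenspace

lemma norm_le_of_mem_spectrum_of_norm_pow_le {𝕜 A : Type*} [NormedField 𝕜] [NormedRing A]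
    [NormedAlgebra 𝕜 A] [CompleteSpace A] {q : A} {C θ : ℝ} (hθ : 0 ≤ θ)
    (hq : ∀ n, ‖q ^ n‖ ≤ C * θ ^ n) {z : 𝕜} (hz : z ∈ spectrum 𝕜 q) : ‖z‖ ≤ θ := by
  by_contra! hlt
  have hz0 : 0 < ‖z‖ := hθ.trans_lt hlt
  have hle (n : ℕ) : 1 ≤ C * ‖(1 : A)‖ * (θ / ‖z‖) ^ n := by
    have hzn := spectrum.norm_le_norm_mul_of_mem (spectrum.pow_mem_pow q n hz)
    rw [div_pow, ← mul_div_assoc, one_le_div (by positivity), ← norm_pow]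
    calc ‖z ^ n‖ ≤ ‖q ^ n‖ * ‖(1 : A)‖ := hzn
      _ ≤ C * θ ^ n * ‖(1 : A)‖ := by gcongr; exact hq n
      _ = C * ‖(1 : A)‖ * θ ^ n := by ring
  have hlim : Tendsto (fun n => C * ‖(1 : A)‖ * (θ / ‖z‖) ^ n) atTop (𝓝 0) := by
    simpa using (tendsto_pow_atTop_nhds_zero_of_lt_one (by positivity)
      ((div_lt_one hz0).2 hlt)).const_mul (C * ‖(1 : A)‖)
  exact absurd (ge_of_tendsto' hlim hle) (by norm_num)

section Fredholm

open scoped LinearMap.FiniteRangeSetoid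
open LinearMap.FiniteRangeSetoid

lemma isFredholm_of_isUnit_of_hasFiniteRange_sub {𝕜 E : Type*} [NontriviallyNormedField 𝕜]
    [CompleteSpace 𝕜] [NormedAddCommGroup E] [NormedSpace 𝕜 E] {U V : E →L[𝕜] E} (hU : IsUnit U)
    (hVU : (V - U : E →ₗ[𝕜] E).HasFiniteRange) : V.IsFredholm := by
  obtain ⟨u, rfl⟩ := hU
  have hinv : (↑u⁻¹ : E →L[𝕜] E).IsQuasiInverse (u : E →L[𝕜] E) := by
    constructor
    · change ((↑u⁻¹ * ↑u : E →L[𝕜] E) : E →ₗ[𝕜] E) ≈ .id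
      rw [Units.inv_mul]
      rfl
    · change ((↑u * ↑u⁻¹ : E →L[𝕜] E) : E →ₗ[𝕜] E) ≈ .id
      rw [Units.mul_inv]
      rfl
  exact .of_isQuasiInverse (hinv.congr (Setoid.refl _) (equiv_iff_hasFiniteRange.2 hVU))

end Fredholm

section SpectralGap

lemma mem_spectrum_of_hasEigenvalue {𝕜 E : Type*} [NontriviallyNormedField 𝕜]
    [NormedAddCommGroup E] [NormedSpace 𝕜 E] {L : E →L[𝕜] E} {z : 𝕜}
    (hz : Module.End.HasEigenvalue (L : E →ₗ[𝕜] E) z) : z ∈ spectrum 𝕜 L :=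
  fun hunit => hz.mem_spectrum (hunit.map (ContinuousLinearMap.toLinearMapRingHom (R₁ := 𝕜)))

variable {E : Type*} [NormedAddCommGroup E] [NormedSpace ℂ E] [CompleteSpace E]
  {L : E →L[ℂ] E} {φ : E →L[ℂ] ℂ} {e : E} {C θ : ℝ}

lemma essSpectralRadius_le_of_norm_pow_le
    (hθ : 0 ≤ θ) (hpow : ∀ n, ‖(L - φ.smulRight e) ^ n‖ ≤ C * θ ^ n) :
    essSpectralRadius L ≤ ENNReal.ofReal θ := by
  refine iSup₂_le fun z hz => ?_
  contrapose! hz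
  have hunit : IsUnit (algebraMap ℂ (E →L[ℂ] E) z - (L - φ.smulRight e)) := by
    by_contra hspec
    have hle := norm_le_of_mem_spectrum_of_norm_pow_le hθ hpow hspec
    exact hz.not_ge (ofReal_norm z ▸ ENNReal.ofReal_le_ofReal hle)
  refine not_not.2 (isFredholm_of_isUnit_of_hasFiniteRange_sub hunit ?_)
  have hdiff : ((z • ContinuousLinearMap.id ℂ E - L : E →L[ℂ] E) : E →ₗ[ℂ] E) -
      ((algebraMap ℂ (E →L[ℂ] E) z - (L - φ.smulRight e) : E →L[ℂ] E) : E →ₗ[ℂ] E) =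
        LinearMap.toSpanSingleton ℂ E (-e) ∘ₗ (φ : E →ₗ[ℂ] ℂ) := by
    ext v
    simp [Algebra.algebraMap_eq_smul_one]
  rw [hdiff]
  exact LinearMap.HasFiniteRange.of_isNoetherian_rng.comp_left _

theorem spectralGap_of_norm_pow_le (hθ : 0 ≤ θ) (hθ1 : θ < 1) (hφe : φ e = 1) (hLe : L e = e)
    (hφL : ∀ v, φ (L v) = φ v) (hpow : ∀ n, ‖(L - φ.smulRight e) ^ n‖ ≤ C * θ ^ n) :
    essSpectralRadius L ≤ ENNReal.ofReal θ ∧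
      Module.End.HasEigenvalue (L : E →ₗ[ℂ] E) 1 ∧
      Module.finrank ℂ (Module.End.maxGenEigenspace (L : E →ₗ[ℂ] E) 1) = 1 ∧
      (∀ z : ℂ, Module.End.HasEigenvalue (L : E →ₗ[ℂ] E) z → ‖z‖ = 1 → z = 1) ∧
      ∃ r : ℝ, r < 1 ∧ ∀ z ∈ spectrum ℂ L, z = 1 ∨ ‖z‖ ≤ r := by
  have he : e ≠ 0 := by
    rintro rfl
    simp at hφe
  have hspec (z : ℂ) (hz : z ∈ spectrum ℂ L) : z = 1 ∨ ‖z‖ ≤ θ := by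
    refine (spectrum_subset_insert_one (p := φ.smulRight e) ?_ ?_ hz).imp_right
      (norm_le_of_mem_spectrum_of_norm_pow_le hθ hpow)
    all_goals
      ext v
      simp [hφe, hLe]
  have hfix (v : E) (hv : L v = v) : v = φ v • e := by
    by_contra hne
    have heig : Module.End.HasEigenvalue ((L - φ.smulRight e : E →L[ℂ] E) : E →ₗ[ℂ] E) 1 := by
      refine Module.End.hasEigenvalue_of_hasEigenvector (x := v - φ v • e)
        ⟨Module.End.mem_eigenspace_iff.2 ?_, sub_ne_zero.2 hne⟩
      simp [hv, hLe, hφe]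
    have hle := norm_le_of_mem_spectrum_of_norm_pow_le hθ hpow
      (mem_spectrum_of_hasEigenvalue heig)
    rw [norm_one] at hle
    exact hle.not_gt hθ1
  refine ⟨essSpectralRadius_le_of_norm_pow_le hθ hpow, ?_, ?_, fun z hz hz1 => ?_, θ, hθ1, hspec⟩
  · exact Module.End.hasEigenvalue_of_hasEigenvector
      ⟨Module.End.mem_eigenspace_iff.2 (by simpa), he⟩
  · rw [maxGenEigenspace_one_eq_span (φ := (φ : E →ₗ[ℂ] ℂ)) hφL hLe hfix,
      finrank_span_singleton he]
  · refine (hspec z (mem_spectrum_of_hasEigenvalue hz)).resolve_right fun hle => ?_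
    exact (hz1 ▸ hle).not_gt hθ1

end SpectralGap

lemma dist_le_one (x y : I) : dist x y ≤ 1 :=
  (Real.dist_le_of_mem_Icc_01 (Ico_subset_Icc_self x.2) (Ico_subset_Icc_self y.2) :)

instance : IsProbabilityMeasure (volume : Measure I) where
  measure_univ := by
    rw [← volume_image_subtype_coe measurableSet_Ico, image_univ, Subtype.range_coe]
    simp

lemma lipConst_nonneg (f : I → ℂ) : 0 ≤ lipConst f :=
  Real.iSup_nonneg fun _ => div_nonneg (norm_nonneg _) dist_nonneg

lemma lipConst_le {f : I → ℂ} {B : ℝ} (hB : 0 ≤ B) (h : ∀ x y, ‖f x - f y‖ ≤ B * dist x y) :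
    lipConst f ≤ B :=
  ciSup_le fun p => div_le_of_le_mul₀ dist_nonneg hB (h p.1 p.2)

namespace Lip

lemma ext {f g : Lip} (h : ∀ x, f x = g x) : f = g := Subtype.ext (funext h)

lemma sub_apply (f g : Lip) (x : I) : (f - g) x = f x - g x := rfl

lemma norm_apply_le (f : Lip) (x : I) : ‖f x‖ ≤ ‖f‖ :=
  (le_ciSup f.bddAbove_sup x).trans (le_add_of_nonneg_right (lipConst_nonneg f))

lemma lipConst_le_norm (f : Lip) : lipConst f ≤ ‖f‖ :=
  le_add_of_nonneg_left (Real.iSup_nonneg fun _ => norm_nonneg _)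

lemma norm_sub_le (f : Lip) (x y : I) : ‖f x - f y‖ ≤ lipConst f * dist x y := by
  rcases eq_or_ne x y with rfl | h
  · simp
  · rw [← div_le_iff₀ (dist_pos.2 h)]
    exact le_ciSup f.bddAbove_lip (x, y)

lemma norm_le_add {f : Lip} {A B : ℝ} (hB : 0 ≤ B) (hA : ∀ x, ‖f x‖ ≤ A)
    (h : ∀ x y, ‖f x - f y‖ ≤ B * dist x y) : ‖f‖ ≤ A + B :=
  add_le_add (ciSup_le hA) (lipConst_le hB h)

lemma norm_le_iff {f : Lip} {C : ℝ} :
    ‖f‖ ≤ C ↔ ∀ x y z, ‖f x‖ + ‖f y - f z‖ / dist y z ≤ C := by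
  refine ⟨fun h x y z => le_trans ?_ h, fun h => ?_⟩
  · exact add_le_add (le_ciSup f.bddAbove_sup x) (le_ciSup f.bddAbove_lip (y, z))
  · rw [norm_def, ← le_sub_iff_add_le]
    refine ciSup_le fun x => ?_
    rw [le_sub_comm]
    exact ciSup_le fun p => le_sub_iff_add_le'.2 (h x p.1 p.2)

lemma continuous (f : Lip) : Continuous (f : I → ℂ) :=
  let ⟨_, hK⟩ := f.2
  hK.continuous

/-- A function with a Lipschitz bound, as an element of `Lip`. -/
def ofBound (f : I → ℂ) (B : ℝ≥0) (h : ∀ x y, ‖f x - f y‖ ≤ B * dist x y) : Lip :=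
  ⟨f, B, LipschitzWith.of_dist_le_mul fun x y => (dist_eq_norm (f x) (f y)).trans_le (h x y)⟩

lemma exists_norm_le_of_tendsto {ι : Type*} {l : Filter ι} [l.NeBot] {u : ι → Lip} {g : I → ℂ}
    {C : ℝ≥0} (hu : ∀ x, Tendsto (fun i => u i x) l (𝓝 (g x))) (hC : ∀ᶠ i in l, ‖u i‖ ≤ C) :
    ∃ G : Lip, (∀ x, G x = g x) ∧ ‖G‖ ≤ C := by
  have hlip : ∀ x y, ‖g x - g y‖ ≤ C * dist x y := fun x y => by
    refine le_of_tendsto ((hu x).sub (hu y)).norm (hC.mono fun i hi => ?_)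
    exact ((u i).norm_sub_le x y).trans (by gcongr; exact (u i).lipConst_le_norm.trans hi)
  refine ⟨ofBound g C hlip, fun x => rfl, norm_le_iff.2 fun x y z => ?_⟩
  refine le_of_tendsto ((hu x).norm.add (((hu y).sub (hu z)).norm.div_const _)) ?_
  exact hC.mono fun i hi => norm_le_iff.1 hi x y z

instance : CompleteSpace Lip := by
  refine Metric.complete_of_cauchySeq_tendsto fun u hu => ?_
  have hpt : ∀ x, ∃ z, Tendsto (fun n => u n x) atTop (𝓝 z) := fun x => by
    have heval : LipschitzWith 1 fun f : Lip => f x := .of_dist_le_mul fun f g => by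
      simpa [dist_eq_norm, sub_apply] using norm_apply_le (f - g) x
    exact cauchySeq_tendsto_of_complete (heval.uniformContinuous.comp_cauchySeq hu)
  choose g hg using hpt
  obtain ⟨R, hR⟩ := hu.norm_bddAbove
  obtain ⟨G, hG, -⟩ := exists_norm_le_of_tendsto (C := R.toNNReal) hg
    (.of_forall fun n => (hR ⟨n, rfl⟩).trans (Real.le_coe_toNNReal R))
  refine ⟨G, Metric.tendsto_atTop'.2 fun ε hε => ?_⟩
  obtain ⟨n₀, hn₀⟩ := Metric.cauchySeq_iff.1 hu (ε / 2) (half_pos hε)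
  refine ⟨n₀, fun n hn => ?_⟩
  obtain ⟨H, hH, hHε⟩ := exists_norm_le_of_tendsto (u := fun m => u n - u m)
    (C := ⟨ε / 2, (half_pos hε).le⟩) (fun x => (hg x).const_sub (u n x))
    ((eventually_ge_atTop n₀).mono fun m hm => by
      rw [← dist_eq_norm]; exact (hn₀ n hn.le m hm).le)
  have : u n - G = H := ext fun x => by rw [hH, sub_apply, hG]
  rw [dist_eq_norm, this]
  exact hHε.trans_lt (half_lt_self hε)

lemma integrable (f : Lip) : Integrable (f : I → ℂ) :=
  .of_bound f.continuous.aestronglyMeasurable ‖f‖ (.of_forall f.norm_apply_le)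

/-- The integral, as a functional on the space of Lipschitz functions. -/
noncomputable def mean : Lip →L[ℂ] ℂ :=
  LinearMap.mkContinuous
    { toFun := fun f => ∫ x, f x
      map_add' := fun f g => integral_add f.integrable g.integrable
      map_smul' := fun c f => integral_const_mul c _ } 1 fun f => by
    have h := norm_integral_le_of_norm_le_const (μ := (volume : Measure I))
      (.of_forall f.norm_apply_le)
    rw [one_mul]
    simpa only [probReal_univ, mul_one] using! h

lemma mean_apply (f : Lip) : mean f = ∫ x, f x := rfl

/-- The constant function `1`, the invariant density. -/
def one : Lip := ofBound (fun _ => 1) 0 fun x y => by simp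

lemma one_apply (x : I) : one x = 1 := rfl

lemma mean_one : mean one = 1 := by simp [mean_apply, one_apply]

lemma norm_le_of_mean_eq_zero {f : Lip} (hf : mean f = 0) : ‖f‖ ≤ 2 * lipConst f := by
  rw [two_mul]
  refine norm_le_add (lipConst_nonneg f) (fun x => ?_) f.norm_sub_le
  have hx : f x = ∫ y, (f x - f y) := by
    rw [integral_sub (integrable_const _) f.integrable, ← mean_apply, hf]
    simp
  have h := norm_integral_le_of_norm_le_const (μ := (volume : Measure I))
    (f := fun y => f x - f y) (C := lipConst f) (.of_forall fun y =>
      (f.norm_sub_le x y).trans (mul_le_of_le_one_right (lipConst_nonneg f) (dist_le_one x y)))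
  simpa [← hx] using h

end Lip

section Variation

variable {α E : Type*} [LinearOrder α] [PseudoEMetricSpace E]

lemma eVariationOn_univ_le_of_dense [TopologicalSpace α] [OrderTopology α] {f : α → E}
    (hf : Continuous f) {D : Set α} (hD : Dense D) :
    eVariationOn f univ ≤ eVariationOn f D := by
  rw [eVariationOn.eVariationOn_eq_strictMonoOn]
  refine iSup_le fun ⟨n, u, hu, _⟩ => le_of_forall_lt fun c hc => ?_
  have hsum : ∀ᶠ v in 𝓝 u, c < ∑ i ∈ Finset.range n, edist (f (v (i + 1))) (f (v i)) :=
    (show Continuous fun v : ℕ → α => ∑ i ∈ Finset.range n, edist (f (v (i + 1))) (f (v i)) by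
      fun_prop).continuousAt.eventually (lt_mem_nhds hc)
  have hmono : ∀ᶠ v in 𝓝 u, StrictMonoOn v (Iic n) :=
    (eventually_all_finite (finite_Iic n)).2 fun i hi =>
      (eventually_all_finite (finite_Iic n)).2 fun j hj => eventually_imp_distrib_left.2 fun hij =>
        (continuous_apply i).continuousAt.eventually_lt (continuous_apply j).continuousAt
          (hu hi hj hij)
  obtain ⟨v, hvD, hvc, hv⟩ := (mem_closure_iff_frequently.1 ((dense_pi univ fun _ _ => hD) u)
    |>.and_eventually (hsum.and hmono)).exists
  exact hvc.trans_le
    (eVariationOn.sum_le_of_monotoneOn_Iic hv.monotoneOn fun i _ => hvD i (mem_univ i))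

lemma eVariationOn_univ_le_of_ae_eq [TopologicalSpace α] [OrderTopology α] [MeasurableSpace α]
    {μ : Measure α} [μ.IsOpenPosMeasure] {f g : α → E} (hf : Continuous f) (hfg : f =ᵐ[μ] g) :
    eVariationOn f univ ≤ eVariationOn g univ :=
  calc eVariationOn f univ
      ≤ eVariationOn f {x | f x = g x} := eVariationOn_univ_le_of_dense hf (μ.dense_of_ae hfg)
    _ = eVariationOn g {x | f x = g x} := eVariationOn.congr fun _ hx => hx
    _ ≤ eVariationOn g univ := eVariationOn.mono g (subset_univ _)

lemma eVariationOn_le_of_monotone {f : α → ℝ} (hf : Monotone f) {C : ℝ}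
    (hC : ∀ x y, f y - f x ≤ C) (s : Set α) : eVariationOn f s ≤ ENNReal.ofReal C := by
  rw [eVariationOn.eq_biSup_inter_Icc]
  refine iSup₂_le fun p hp => ?_
  rw [(hf.monotoneOn s).eVariationOn_eq hp.1 hp.2.1]
  exact ENNReal.ofReal_le_ofReal (hC _ _)

/- An interval splits the line into three parts, so that its indicator function is the composition
of a monotone function with values in `{0, 1, 2}` and of the tent function. -/
lemma eVariationOn_indicator_le {S : Set α} (hS : S.OrdConnected) (s : Set α) :
    eVariationOn (S.indicator fun _ => (1 : ℂ)) s ≤ 2 := by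
  classical
  obtain ⟨A, hSA, hA, hAS⟩ : ∃ A, S ⊆ A ∧ IsUpperSet A ∧ IsUpperSet (A \ S) := by
    refine ⟨upperClosure S, subset_upperClosure, (upperClosure S).upper, fun x y hxy hx => ?_⟩
    obtain ⟨z, hz, hzx⟩ := mem_upperClosure.1 hx.1
    exact ⟨(upperClosure S).upper hxy hx.1, fun hy => hx.2 (hS.out hz hy ⟨hzx, hxy⟩)⟩
  let φ : α → ℝ := fun x => if x ∈ S then 1 else if x ∈ A then 2 else 0
  have hφ : Monotone φ := fun x y hxy => by
    have h₁ := @hA x y hxy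
    have h₂ := @hAS x y hxy
    have h₃ := @hSA x
    simp only [φ]
    grind
  have hφ02 : ∀ x, 0 ≤ φ x ∧ φ x ≤ 2 := fun x => by
    simp only [φ]
    split_ifs <;> norm_num
  have htent : LipschitzWith 1 fun t : ℝ => ((1 - |t - 1| : ℝ) : ℂ) :=
    .of_dist_le_mul fun t t' => by
      rw [Complex.dist_eq, ← Complex.ofReal_sub, Complex.norm_real, Real.norm_eq_abs,
        NNReal.coe_one, one_mul, Real.dist_eq, sub_sub_sub_cancel_left, abs_sub_comm t t']
      exact (abs_abs_sub_abs_le _ _).trans_eq (by rw [sub_sub_sub_cancel_right])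
  have hcomp : S.indicator (fun _ => (1 : ℂ)) = (fun t : ℝ => ((1 - |t - 1| : ℝ) : ℂ)) ∘ φ := by
    funext x
    simp only [comp_apply, φ, indicator_apply]
    split_ifs <;> norm_num
  calc eVariationOn (S.indicator fun _ => (1 : ℂ)) s
      ≤ (1 : ℝ≥0) * eVariationOn φ s := by
        rw [hcomp]
        exact htent.lipschitzOnWith.comp_eVariationOn_le (mapsTo_univ φ s)
    _ ≤ 2 := by
        rw [ENNReal.coe_one, one_mul, ← ENNReal.ofReal_ofNat]
        exact eVariationOn_le_of_monotone hφ (fun x y => by linarith [hφ02 x, hφ02 y]) s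

end Variation

instance : (volume : Measure I).IsOpenPosMeasure where
  open_pos := by
    rintro _ ⟨V, hV, rfl⟩ ⟨x, hx⟩
    have hne : (V ∩ Ioo 0 1).Nonempty := mem_closure_iff.1
      (closure_Ioo (zero_ne_one (α := ℝ)) ▸ Ico_subset_Icc_self x.2) V hV hx
    rw [← volume_image_subtype_coe measurableSet_Ico, Subtype.image_preimage_coe]
    refine (((hV.inter isOpen_Ioo).measure_pos volume hne).trans_le (measure_mono ?_)).ne'
    exact subset_inter (inter_subset_right.trans Ioo_subset_Ico_self) inter_subset_left

/-- The least variation of a function that is almost everywhere equal to `f`: the seminorm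
that occurs in `essBVNorm`. -/
noncomputable def essVariation (f : I → ℂ) : ℝ≥0∞ :=
  ⨅ (g : I → ℂ) (_ : f =ᵐ[volume] g), eVariationOn g univ

lemma essVariation_le_eVariationOn (f : I → ℂ) : essVariation f ≤ eVariationOn f univ :=
  iInf₂_le f .rfl

lemma essVariation_eq_eVariationOn {f : I → ℂ} (hf : Continuous f) :
    essVariation f = eVariationOn f univ :=
  (essVariation_le_eVariationOn f).antisymm
    (le_iInf₂ fun _ hg => eVariationOn_univ_le_of_ae_eq hf hg)

lemma essVariation_le_bvNorm (f : I → ℂ) : essVariation f ≤ bvNorm f :=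
  (essVariation_le_eVariationOn f).trans (le_add_left le_rfl)

lemma essVariation_le_essBVNorm (f : I → ℂ) : essVariation f ≤ essBVNorm f :=
  le_add_left le_rfl

lemma bvNorm_indicator_le {S : Set I} (hS : S.OrdConnected) :
    bvNorm (S.indicator fun _ => 1) ≤ 3 := by
  rw [bvNorm, show (3 : ℝ≥0∞) = 1 + 2 by norm_num]
  refine add_le_add (iSup_le fun x => ?_) (eVariationOn_indicator_le hS _)
  exact (enorm_indicator_le_enorm_self _ _).trans_eq enorm_one

lemma essBVNorm_indicator_le {S : Set I} (hS : S.OrdConnected) :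
    essBVNorm (S.indicator fun _ => 1) ≤ 3 := by
  rw [essBVNorm, show (3 : ℝ≥0∞) = 1 + 2 by norm_num]
  refine add_le_add ?_ ((essVariation_le_eVariationOn _).trans (eVariationOn_indicator_le hS _))
  refine (lintegral_mono fun x => enorm_indicator_le_enorm_self _ _).trans_eq ?_
  simp

/-- The standing assumptions on the weights: `a n` for `n ≥ 1` is a positive summable sequence
whose intervals `I_n` leave room for a nondegenerate `J`. -/
structure IsWeight (a : ℕ → ℝ) : Prop where
  pos : ∀ n : ℕ+, 0 < a n
  summable : Summable fun n : ℕ+ => a n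
  leftEndJ_lt_one : leftEndJ a < 1

section Weights

variable {a : ℕ → ℝ}

lemma leftEnd_zero : leftEnd a 0 = 0 := by simp [leftEnd]

lemma leftEnd_one : leftEnd a 1 = 0 := by simp [leftEnd]

lemma leftEnd_succ {n : ℕ} (hn : 1 ≤ n) : leftEnd a (n + 1) = leftEnd a n + 4 * a n := by
  rw [leftEnd, Finset.sum_Ico_succ_top hn, leftEnd, mul_add]

namespace IsWeight

variable (ha : IsWeight a)
include ha

lemma monotone_leftEnd : Monotone (leftEnd a) := by
  refine monotone_nat_of_le_succ fun n => ?_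
  rcases Nat.eq_zero_or_pos n with rfl | hn
  · rw [leftEnd_zero, leftEnd_one]
  · rw [leftEnd_succ hn]
    exact le_add_of_nonneg_right (mul_nonneg zero_le_four (ha.pos ⟨n, hn⟩).le)

lemma tendsto_leftEnd : Tendsto (leftEnd a) atTop (𝓝 (leftEndJ a)) := by
  rw [← tendsto_add_atTop_iff_nat 1]
  have hsum : HasSum (fun n : ℕ => a (n + 1)) (∑' n : ℕ+, a n) :=
    Equiv.pnatEquivNat.symm.hasSum_iff.2 ha.summable.hasSum
  refine (hsum.tendsto_sum_nat.const_mul 4).congr fun n => ?_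
  simp only [leftEnd, Finset.sum_Ico_eq_sum_range, add_tsub_cancel_right, add_comm 1]

lemma four_mul_le_leftEndJ (n : ℕ+) : 4 * a n ≤ leftEndJ a :=
  mul_le_mul_of_nonneg_left (ha.summable.le_tsum n fun m _ => (ha.pos m).le) (by norm_num)

lemma leftEndJ_pos : 0 < leftEndJ a :=
  (mul_pos four_pos (ha.pos 1)).trans_le (ha.four_mul_le_leftEndJ 1)

end IsWeight

end Weights

lemma biUnion_lt_Ico_map_succ {α : Type*} [LinearOrder α] {f : ℕ → α} (hf : Monotone f) (n : ℕ) :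
    ⋃ i < n, Ico (f i) (f (i + 1)) = Ico (f 0) (f n) := by
  induction n with
  | zero => simp
  | succ n ih =>
    rw [biUnion_lt_succ, ih, Ico_union_Ico_eq_Ico (hf n.zero_le) (hf n.le_succ)]

lemma iUnion_Ico_map_succ_eq_Ico {α : Type*} [LinearOrder α] [TopologicalSpace α]
    [OrderTopology α] {f : ℕ → α} {l : α} (hf : Monotone f) (hl : Tendsto f atTop (𝓝 l)) :
    ⋃ n, Ico (f n) (f (n + 1)) = Ico (f 0) l := by
  refine Subset.antisymm (iUnion_subset fun n => Ico_subset_Ico (hf n.zero_le)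
    (hf.ge_of_tendsto hl _)) fun x hx => ?_
  obtain ⟨n, hn⟩ := (hl.eventually_const_lt hx.2).exists
  have hmem : x ∈ ⋃ i < n, Ico (f i) (f (i + 1)) := by
    rw [biUnion_lt_Ico_map_succ hf]
    exact ⟨hx.1, hn⟩
  exact iUnion₂_subset_iUnion _ _ hmem

section Branch

variable {N : ℕ} {X : Type*} {s : Branch N → Set X}

lemma iUnion_branch : ⋃ b, s b = (⋃ n, s (.v n) ∪ s (.w n)) ∪ ⋃ j, s (.affine j) := by
  ext x
  simp only [mem_iUnion, mem_union]
  constructor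
  · rintro ⟨n | n | j, hx⟩
    exacts [.inl ⟨n, .inl hx⟩, .inl ⟨n, .inr hx⟩, .inr ⟨j, hx⟩]
  · rintro (⟨n, hx | hx⟩ | ⟨j, hx⟩)
    exacts [⟨_, hx⟩, ⟨_, hx⟩, ⟨_, hx⟩]

lemma pairwise_disjoint_branch (hvw : ∀ n, Disjoint (s (.v n)) (s (.w n)))
    (hpair : Pairwise (Disjoint on fun n => s (.v n) ∪ s (.w n)))
    (haff : Pairwise (Disjoint on fun j => s (.affine j)))
    (hpa : ∀ n j, Disjoint (s (.v n) ∪ s (.w n)) (s (.affine j))) :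
    Pairwise (Disjoint on s) := by
  have hne {m n : ℕ+} (h : m ≠ n) := disjoint_union_left.1 (hpair h)
  have hv (n j) := (disjoint_union_left.1 (hpa n j)).1
  have hw (n j) := (disjoint_union_left.1 (hpa n j)).2
  rintro (m | m | i) (n | n | j) hb
  · exact (disjoint_union_right.1 (hne (ne_of_apply_ne _ hb)).1).1
  · obtain rfl | h := eq_or_ne m n
    exacts [hvw m, (disjoint_union_right.1 (hne h).1).2]
  · exact hv m j
  · obtain rfl | h := eq_or_ne m n
    exacts [(hvw m).symm, (disjoint_union_right.1 (hne h).2).1]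
  · exact (disjoint_union_right.1 (hne (ne_of_apply_ne _ hb)).2).2
  · exact hw m j
  · exact (hv n i).symm
  · exact (hw n i).symm
  · exact haff (ne_of_apply_ne _ hb)

end Branch

section Partition

variable {a : ℕ → ℝ} {N : ℕ}

lemma piece_affine (j : Fin N) : piece a N (.affine j) =
    Ico (leftEndJ a + (j : ℕ) * ((1 - leftEndJ a) / N))
      (leftEndJ a + (j + 1 : ℕ) * ((1 - leftEndJ a) / N)) := by
  simp only [piece, left, length, Nat.cast_add_one, add_one_mul, add_assoc]

lemma disjoint_piece_v_piece_w (n : ℕ+) : Disjoint (piece a N (.v n)) (piece a N (.w n)) :=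
  Ico_disjoint_Ico_same

namespace IsWeight

variable (ha : IsWeight a)
include ha

lemma length_pos (b : Branch N) : 0 < length a N b := by
  rcases b with n | n | j
  · exact mul_pos two_pos (ha.pos n)
  · exact mul_pos two_pos (ha.pos n)
  · exact div_pos (sub_pos.2 ha.leftEndJ_lt_one) (Nat.cast_pos.2 j.pos)

lemma piece_v_union_piece_w (n : ℕ+) :
    piece a N (.v n) ∪ piece a N (.w n) = Ico (leftEnd a n) (leftEnd a (n + 1)) := by
  have hpos := ha.pos n
  simp only [piece, left, length]
  rw [Ico_union_Ico_eq_Ico (by linarith) (by linarith),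
    leftEnd_succ (show 1 ≤ (n : ℕ) from n.2)]
  congr 1
  ring

lemma iUnion_piece_v_union_piece_w :
    ⋃ n, piece a N (.v n) ∪ piece a N (.w n) = Ico 0 (leftEndJ a) := by
  simp_rw [ha.piece_v_union_piece_w]
  rw [← leftEnd_one (a := a), ← zero_add 1,
    ← iUnion_Ico_map_succ_eq_Ico (f := fun n => leftEnd a (n + 1))
      (ha.monotone_leftEnd.comp fun m n h => Nat.succ_le_succ h)
      ((tendsto_add_atTop_iff_nat 1).2 ha.tendsto_leftEnd)]
  exact Equiv.pnatEquivNat.symm.surjective.iUnion_comp _ |>.symm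

lemma monotone_affineEnd : Monotone fun j : ℕ => leftEndJ a + j * ((1 - leftEndJ a) / N) := by
  have hJ : 0 ≤ 1 - leftEndJ a := (sub_pos.2 ha.leftEndJ_lt_one).le
  intro i j hij
  dsimp only
  gcongr

lemma iUnion_piece_affine [NeZero N] : ⋃ j, piece a N (.affine j) = Ico (leftEndJ a) 1 := by
  have hN : (N : ℝ) ≠ 0 := NeZero.ne _
  have h := biUnion_lt_Ico_map_succ (ha.monotone_affineEnd (N := N)) N
  simp only [Nat.cast_zero, zero_mul, add_zero, mul_div_cancel₀ _ hN, add_sub_cancel] at h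
  rw [← h]
  ext y
  simp only [mem_iUnion, piece_affine, Fin.exists_iff]

lemma iUnion_piece [NeZero N] : ⋃ b : Branch N, piece a N b = Ico 0 1 := by
  rw [iUnion_branch, ha.iUnion_piece_v_union_piece_w, ha.iUnion_piece_affine,
    Ico_union_Ico_eq_Ico ha.leftEndJ_pos.le ha.leftEndJ_lt_one.le]

lemma disjoint_piece : Pairwise (Disjoint on piece a N) := by
  refine pairwise_disjoint_branch disjoint_piece_v_piece_w ?_ ?_ fun n j => ?_
  · simp_rw [ha.piece_v_union_piece_w]
    exact fun m n h => ha.monotone_leftEnd.pairwise_disjoint_on_Ico_succ (PNat.coe_injective.ne h)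
  · simp_rw [piece_affine]
    exact fun i j h => (ha.monotone_affineEnd (N := N)).pairwise_disjoint_on_Ico_succ
      (Fin.val_injective.ne h)
  · have : NeZero N := ⟨j.pos.ne'⟩
    refine (Ico_disjoint_Ico_same (a := 0) (b := leftEndJ a) (c := 1)).mono ?_ ?_
    · rw [← ha.iUnion_piece_v_union_piece_w (N := N)]
      exact subset_iUnion (fun n => piece a N (.v n) ∪ piece a N (.w n)) n
    · rw [← ha.iUnion_piece_affine (N := N)]
      exact subset_iUnion (fun j => piece a N (.affine j)) j

end IsWeight

end Partition

lemma hasDerivWithinAt_image_of_leftInvOn {𝕜 : Type*} [NontriviallyNormedField 𝕜]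
    [CompleteSpace 𝕜] {f g : 𝕜 → 𝕜} {s : Set 𝕜} {f' x : 𝕜} (hf : HasStrictDerivAt f f' x)
    (hf' : f' ≠ 0) (hinj : Injective f) (hg : LeftInvOn g f s) (hx : x ∈ s) :
    HasDerivWithinAt g f'⁻¹ (f '' s) (f x) := by
  have heq : ∀ᶠ y in 𝓝[f '' s] f x, g y = hf.localInverse f f' x hf' y := by
    filter_upwards [self_mem_nhdsWithin, nhdsWithin_le_nhds (hf.hasStrictFDerivAt_equiv
      hf').eventually_right_inverse]
    rintro _ ⟨z, hz, rfl⟩ hy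
    rw [hg hz]
    exact (hinj hy).symm
  exact (hf.to_localInverse hf').hasDerivAt.hasDerivWithinAt.congr_of_eventuallyEq heq
    (heq.self_of_nhdsWithin ⟨x, hx, rfl⟩)

section BranchDeriv

variable (a : ℕ → ℝ) (N : ℕ)

lemma branchDeriv_v (n : ℕ+) (x : ℝ) :
    branchDeriv a N (.v n) x = a n * (2 + Real.cos (4 * Real.pi * n ^ 4 * x)) := by
  rw [branchDeriv, show 4 * Real.pi * (n : ℝ) ^ 4 * x = 2 * (2 * Real.pi * n ^ 4 * x) by ring,
    Real.cos_two_mul]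
  ring

lemma branchDeriv_w (n : ℕ+) (x : ℝ) :
    branchDeriv a N (.w n) x = a n * (2 - Real.cos (4 * Real.pi * n ^ 4 * x)) := by
  rw [branchDeriv, show 4 * Real.pi * (n : ℝ) ^ 4 * x = 2 * (2 * Real.pi * n ^ 4 * x) by ring,
    Real.cos_two_mul, Real.cos_sq']
  ring

lemma branchDeriv_v_add_branchDeriv_w (n : ℕ+) (x : ℝ) :
    branchDeriv a N (.v n) x + branchDeriv a N (.w n) x = 4 * a n := by
  rw [branchDeriv_v, branchDeriv_w]
  ring

lemma continuous_branchDeriv (b : Branch N) : Continuous (branchDeriv a N b) := by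
  rcases b with n | n | _
  · simp only [funext (branchDeriv_v a N n)]
    fun_prop
  · simp only [funext (branchDeriv_w a N n)]
    fun_prop
  · exact continuous_const

lemma integral_cos_four_pi_mul (n : ℕ+) :
    ∫ t in (0 : ℝ)..1, Real.cos (4 * Real.pi * n ^ 4 * t) = 0 := by
  have hsin : Real.sin (4 * Real.pi * n ^ 4) = 0 := by
    rw [show 4 * Real.pi * (n : ℝ) ^ 4 = (4 * (n : ℕ) ^ 4 : ℕ) * Real.pi by push_cast; ring]
    exact Real.sin_nat_mul_pi _
  rw [intervalIntegral.integral_comp_mul_left (fun t => Real.cos t) (by positivity), integral_cos]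
  simp [hsin]

lemma integral_branchDeriv (b : Branch N) :
    ∫ t in (0 : ℝ)..1, branchDeriv a N b t = length a N b := by
  have hcos (n : ℕ+) : IntervalIntegrable (fun t : ℝ => Real.cos (4 * Real.pi * n ^ 4 * t))
      volume 0 1 := Continuous.intervalIntegrable (by fun_prop) _ _
  rcases b with n | n | j
  · simp_rw [branchDeriv_v]
    rw [intervalIntegral.integral_const_mul, intervalIntegral.integral_add (by simp) (hcos n),
      integral_cos_four_pi_mul]
    simp [length, mul_comm]
  · simp_rw [branchDeriv_w]
    rw [intervalIntegral.integral_const_mul, intervalIntegral.integral_sub (by simp) (hcos n),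
      integral_cos_four_pi_mul]
    simp [length, mul_comm]
  · simp [branchDeriv, length]

lemma hasStrictDerivAt_branch (b : Branch N) (x : ℝ) :
    HasStrictDerivAt (branch a N b) (branchDeriv a N b x) x :=
  (intervalIntegral.integral_hasStrictDerivAt_right
    ((continuous_branchDeriv a N b).intervalIntegrable 0 x)
    (continuous_branchDeriv a N b).stronglyMeasurable.stronglyMeasurableAtFilter
    (continuous_branchDeriv a N b).continuousAt).const_add _

lemma hasDerivAt_branch (b : Branch N) (x : ℝ) :
    HasDerivAt (branch a N b) (branchDeriv a N b x) x :=
  (hasStrictDerivAt_branch a N b x).hasDerivAt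

lemma continuous_branch (b : Branch N) : Continuous (branch a N b) :=
  continuous_iff_continuousAt.2 fun x => (hasDerivAt_branch a N b x).continuousAt

lemma piece_eq_Ico_branch (b : Branch N) :
    piece a N b = Ico (branch a N b 0) (branch a N b 1) := by
  simp only [piece, branch, intervalIntegral.integral_same, add_zero, integral_branchDeriv]

end BranchDeriv

namespace IsWeight

variable {a : ℕ → ℝ} {N : ℕ} (ha : IsWeight a)
include ha

lemma branchDeriv_pos (b : Branch N) (x : ℝ) : 0 < branchDeriv a N b x := by
  rcases b with n | n | j
  · have := ha.pos n
    rw [branchDeriv]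
    positivity
  · have := ha.pos n
    rw [branchDeriv]
    positivity
  · exact ha.length_pos (.affine j)

lemma branchDeriv_v_le (n : ℕ+) (x : ℝ) : branchDeriv a N (.v n) x ≤ 3 * a n := by
  rw [branchDeriv_v]
  nlinarith [ha.pos n, Real.cos_le_one (4 * Real.pi * (n : ℝ) ^ 4 * x)]

lemma branchDeriv_w_le (n : ℕ+) (x : ℝ) : branchDeriv a N (.w n) x ≤ 3 * a n := by
  rw [branchDeriv_w]
  nlinarith [ha.pos n, Real.neg_one_le_cos (4 * Real.pi * (n : ℝ) ^ 4 * x)]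

lemma branchDeriv_le (b : Branch N) (x : ℝ) :
    branchDeriv a N b x ≤ max (3 / 4) (1 - leftEndJ a) := by
  have hJ := ha.leftEndJ_lt_one
  have hle (n : ℕ+) : 3 * a n ≤ 3 / 4 := by linarith [ha.four_mul_le_leftEndJ n]
  rcases b with n | n | j
  · exact le_max_of_le_left ((ha.branchDeriv_v_le n x).trans (hle n))
  · exact le_max_of_le_left ((ha.branchDeriv_w_le n x).trans (hle n))
  · exact le_max_of_le_right (div_le_self (sub_pos.2 hJ).le (Nat.one_le_cast.2 j.pos))

lemma strictMono_branch (b : Branch N) : StrictMono (branch a N b) :=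
  strictMono_of_hasDerivAt_pos (hasDerivAt_branch a N b) (ha.branchDeriv_pos b)

lemma bijOn_branch (b : Branch N) : BijOn (branch a N b) (Ico 0 1) (piece a N b) := by
  have hmono := ha.strictMono_branch b
  rw [piece_eq_Ico_branch]
  exact ⟨fun x hx => ⟨hmono.monotone hx.1, hmono hx.2⟩, hmono.injective.injOn,
    intermediate_value_Ico zero_le_one (continuous_branch a N b).continuousOn⟩

lemma injective_branch : Injective fun p : Branch N × I => branch a N p.1 p.2 := by
  rintro ⟨b, x⟩ ⟨b', x'⟩ h
  have hmem (b : Branch N) (x : I) := (ha.bijOn_branch b).mapsTo x.2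
  obtain rfl : b = b' := by_contra fun hb =>
    disjoint_left.1 (ha.disjoint_piece hb) (hmem b x) ((congrArg (· ∈ _) h).mpr (hmem b' x'))
  exact congrArg (b, ·) (Subtype.ext ((ha.strictMono_branch b).injective h))

lemma intervalMap_eq {b : Branch N} {x y : I} (h : (y : ℝ) = branch a N b x) :
    intervalMap a N y = x := by
  rw [intervalMap, h]
  exact congrArg Prod.snd (leftInverse_invFun ha.injective_branch (b, x))

end IsWeight

/-- The inverse branch `b` of the map `T`, as a map of `I` to itself. -/
noncomputable def IsWeight.branchMap {a : ℕ → ℝ} {N : ℕ} [NeZero N] (ha : IsWeight a)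
    (b : Branch N) (x : I) : I :=
  ⟨branch a N b x,
    ha.iUnion_piece.subset (mem_iUnion_of_mem b ((ha.bijOn_branch b).mapsTo x.2))⟩

/-- The derivative of the inverse branch `b` as a nonnegative number, which makes it a density
with respect to Lebesgue measure. -/
noncomputable def branchDensity (a : ℕ → ℝ) (N : ℕ) (b : Branch N) (x : I) : ℝ≥0 :=
  (branchDeriv a N b x).toNNReal

lemma measurable_branchDensity (a : ℕ → ℝ) (N : ℕ) (b : Branch N) :
    Measurable (branchDensity a N b) :=
  ((continuous_branchDeriv a N b).comp continuous_subtype_val).measurable.real_toNNReal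

instance : StandardBorelSpace I := measurableSet_Ico.standardBorel

namespace IsWeight

variable {a : ℕ → ℝ} {N : ℕ}

lemma coe_branchDensity (ha : IsWeight a) (b : Branch N) (x : I) :
    (branchDensity a N b x : ℝ) = branchDeriv a N b x :=
  Real.coe_toNNReal _ (ha.branchDeriv_pos b x).le

variable [NeZero N] (ha : IsWeight a)

lemma continuous_branchMap (b : Branch N) : Continuous (ha.branchMap b) :=
  ((continuous_branch a N b).comp continuous_subtype_val).subtype_mk _

lemma injective_branchMap (b : Branch N) : Injective (ha.branchMap b) := fun _ _ h =>
  Subtype.ext ((ha.strictMono_branch b).injective (congrArg Subtype.val h))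

lemma intervalMap_branchMap (b : Branch N) (x : I) : intervalMap a N (ha.branchMap b x) = x :=
  ha.intervalMap_eq rfl

lemma disjoint_range_branchMap :
    Pairwise (Disjoint on fun b : Branch N => range (ha.branchMap b)) := by
  intro b b' hb
  refine disjoint_left.2 ?_
  rintro _ ⟨x, rfl⟩ ⟨y, hy⟩
  exact hb (congrArg Prod.fst
    (ha.injective_branch (a₁ := (b, x)) (a₂ := (b', y)) (congrArg Subtype.val hy.symm)))

lemma exists_branchMap_eq (y : I) : ∃ (b : Branch N) (x : I), ha.branchMap b x = y := by
  obtain ⟨b, hb⟩ := mem_iUnion.1 (ha.iUnion_piece (N := N).symm.subset y.2)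
  obtain ⟨x, hx, hxy⟩ := (ha.bijOn_branch b).surjOn hb
  exact ⟨b, ⟨x, hx⟩, Subtype.ext hxy⟩

lemma setLIntegral_branchDensity (b : Branch N) {A : Set I} (hA : MeasurableSet A) :
    ∫⁻ x in A, branchDensity a N b x = volume (ha.branchMap b '' A) := by
  have himage : (↑) '' (ha.branchMap b '' A) = branch a N b '' ((↑) '' A : Set ℝ) := by
    simp only [image_image, branchMap]
  rw [← volume_image_subtype_coe measurableSet_Ico, himage,
    ← lintegral_deriv_eq_volume_image_of_monotoneOn (measurableSet_Ico.subtype_image hA)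
      (fun x _ => (hasDerivAt_branch a N b x).hasDerivWithinAt)
      ((ha.strictMono_branch b).monotone.monotoneOn _)]
  exact setLIntegral_subtype measurableSet_Ico A fun x => ENNReal.ofReal (branchDeriv a N b x)

lemma isFullBranchSystem :
    IsFullBranchSystem volume (intervalMap a N) ha.branchMap (branchDensity a N) where
  measurableEmbedding b :=
    (ha.continuous_branchMap b).measurable.measurableEmbedding (ha.injective_branchMap b)
  leftInverse := ha.intervalMap_branchMap
  disjoint_range := ha.disjoint_range_branchMap
  iUnion_range := iUnion_eq_univ_iff.2 fun y => ha.exists_branchMap_eq y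
  measurable_density := measurable_branchDensity a N
  setLIntegral_density b _ hA := ha.setLIntegral_branchDensity b hA

lemma rightDeriv_branchMap (b : Branch N) (x : I) :
    rightDeriv (intervalMap a N) (ha.branchMap b x) = (branchDeriv a N b x)⁻¹ := by
  have hinv : LeftInvOn (extend Subtype.val (fun z : I => (intervalMap a N z : ℝ)) 0)
      (branch a N b) (Ico 0 1) := fun t ht => by
    refine (Subtype.val_injective.extend_apply _ _ (ha.branchMap b ⟨t, ht⟩)).trans ?_
    rw [ha.intervalMap_branchMap]
  have hderiv := hasDerivWithinAt_image_of_leftInvOn (hasStrictDerivAt_branch a N b x)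
    (ha.branchDeriv_pos b x).ne' (ha.strictMono_branch b).injective hinv x.2
  have hmem := (ha.bijOn_branch b).mapsTo x.2
  rw [(ha.bijOn_branch b).image_eq] at hderiv
  refine (hderiv.mono_of_mem_nhdsWithin ?_).derivWithin
    (uniqueDiffOn_Ico _ _ _ (left_mem_Ico.2 (ha.branchMap b x).2.2))
  exact nhdsWithin_mono _ Ico_subset_Ici_self
    (mem_of_superset (Ico_mem_nhdsGE hmem.2) (Ico_subset_Ico_left hmem.1))

include ha in
lemma exists_one_lt_le_rightDeriv : ∃ κ : ℝ, 1 < κ ∧ ∀ y, κ ≤ rightDeriv (intervalMap a N) y := by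
  have hpos : (0 : ℝ) < max (3 / 4) (1 - leftEndJ a) := lt_max_of_lt_left (by norm_num)
  refine ⟨(max (3 / 4) (1 - leftEndJ a))⁻¹, (one_lt_inv₀ hpos).2
    (max_lt (by norm_num) (by linarith [ha.leftEndJ_pos])), fun y => ?_⟩
  obtain ⟨b, x, rfl⟩ := ha.exists_branchMap_eq (N := N) y
  rw [ha.rightDeriv_branchMap]
  exact inv_anti₀ (ha.branchDeriv_pos b x) (ha.branchDeriv_le b x)

lemma transfer_apply (f : I → ℂ) (x : I) : transfer (intervalMap a N) f x =
    ∑' b : Branch N, (branchDeriv a N b x : ℂ) * f (ha.branchMap b x) := by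
  rw [transfer, ha.isFullBranchSystem.tsum_fiber (fun y => f y / (rightDeriv _ y : ℂ))]
  simp only [ha.rightDeriv_branchMap, Complex.ofReal_inv, div_inv_eq_mul, mul_comm]

lemma transfer_eq_tsum_smul (f : I → ℂ) : transfer (intervalMap a N) f =
    fun x => ∑' b : Branch N, branchDensity a N b x • f (ha.branchMap b x) := by
  funext x
  simp only [ha.transfer_apply, NNReal.smul_def, ha.coe_branchDensity, Complex.real_smul]

end IsWeight

section Sums

/-- The index set of the branches as a disjoint union. -/
def branchEquiv (N : ℕ) : (ℕ+ ⊕ ℕ+) ⊕ Fin N ≃ Branch N where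
  toFun
    | .inl (.inl n) => .v n
    | .inl (.inr n) => .w n
    | .inr j => .affine j
  invFun
    | .v n => .inl (.inl n)
    | .w n => .inl (.inr n)
    | .affine j => .inr j
  left_inv := by rintro ((n | n) | j) <;> rfl
  right_inv := by rintro (n | n | j) <;> rfl

instance (N : ℕ) : Countable (Branch N) := (branchEquiv N).symm.injective.countable

variable {E : Type*} {N : ℕ} {f : Branch N → E}

lemma hasSum_branch [AddCommMonoid E] [TopologicalSpace E] [ContinuousAdd E] {s t : E}
    (hv : HasSum (fun n => f (.v n)) s) (hw : HasSum (fun n => f (.w n)) t) :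
    HasSum f (s + t + ∑ j, f (.affine j)) :=
  (branchEquiv N).hasSum_iff.1 ((hv.sum hw).sum (hasSum_fintype _))

lemma tsum_branch [NormedAddCommGroup E] [CompleteSpace E] (hf : Summable f) :
    ∑' b, f b = ∑' n, (f (.v n) + f (.w n)) + ∑ j, f (.affine j) := by
  have hv : Summable fun n => f (.v n) := hf.comp_injective fun _ _ => Branch.v.inj
  have hw : Summable fun n => f (.w n) := hf.comp_injective fun _ _ => Branch.w.inj
  rw [hv.tsum_add hw, (hasSum_branch hv.hasSum hw.hasSum).tsum_eq]

end Sums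

namespace IsWeight

variable {a : ℕ → ℝ} {N : ℕ} [NeZero N] (ha : IsWeight a)
include ha

lemma hasSum_branchDeriv (x : ℝ) : HasSum (fun b : Branch N => branchDeriv a N b x) 1 := by
  have hv : Summable fun n : ℕ+ => branchDeriv a N (.v n) x :=
    .of_nonneg_of_le (fun n => (ha.branchDeriv_pos _ x).le)
      (fun n => ha.branchDeriv_v_le n x) (ha.summable.mul_left 3)
  have hw : Summable fun n : ℕ+ => branchDeriv a N (.w n) x :=
    .of_nonneg_of_le (fun n => (ha.branchDeriv_pos _ x).le)
      (fun n => ha.branchDeriv_w_le n x) (ha.summable.mul_left 3)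
  have hpairs : ∑' n : ℕ+, branchDeriv a N (.v n) x + ∑' n : ℕ+, branchDeriv a N (.w n) x =
      leftEndJ a := by
    rw [← hv.tsum_add hw, leftEndJ, ← tsum_mul_left]
    exact tsum_congr fun n => branchDeriv_v_add_branchDeriv_w a N n x
  have haffine : ∑ j : Fin N, branchDeriv a N (.affine j) x = 1 - leftEndJ a := by
    simp only [branchDeriv, Finset.sum_const, Finset.card_univ, Fintype.card_fin, nsmul_eq_mul]
    exact mul_div_cancel₀ _ (NeZero.ne _)
  have h := hasSum_branch (f := fun b : Branch N => branchDeriv a N b x) hv.hasSum hw.hasSum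
  rwa [hpairs, haffine, add_sub_cancel] at h

lemma measurePreserving_intervalMap : MeasurePreserving (intervalMap a N) volume volume := by
  refine ha.isFullBranchSystem.measurePreserving fun x => ?_
  have h := ha.hasSum_branchDeriv (N := N) x
  simp_rw [← ha.coe_branchDensity] at h
  exact (ENNReal.hasSum_coe.2 (NNReal.hasSum_coe.1 h)).tsum_eq

variable {f g : I → ℂ}

lemma integrable_transfer (hf : Integrable f) : Integrable (transfer (intervalMap a N) f) := by
  rw [ha.transfer_eq_tsum_smul]
  exact ha.isFullBranchSystem.integrable_tsum_branch hf

lemma integral_transfer (hf : Integrable f) :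
    ∫ x, transfer (intervalMap a N) f x = ∫ x, f x := by
  rw [ha.transfer_eq_tsum_smul]
  exact ha.isFullBranchSystem.integral_tsum_branch hf

lemma integral_mul_comp_intervalMap (hf : Integrable f) (hg : Measurable g) {C : ℝ}
    (hC : ∀ x, ‖g x‖ ≤ C) :
    ∫ x, f x * g (intervalMap a N x) = ∫ x, transfer (intervalMap a N) f x * g x := by
  rw [ha.transfer_eq_tsum_smul]
  exact ha.isFullBranchSystem.integral_mul_comp hf hg hC

end IsWeight

lemma norm_pow_sub_mean_le {L : Lip →L[ℂ] Lip} {θ : ℝ} (hθ : 0 ≤ θ)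
    (hmean : ∀ f, Lip.mean (L f) = Lip.mean f) (hL : ∀ f, lipConst (L f) ≤ θ * lipConst f)
    (n : ℕ) : ‖(L - Lip.mean.smulRight Lip.one) ^ n‖ ≤ 2 * θ ^ n := by
  set Q := L - Lip.mean.smulRight Lip.one
  have hQ_apply (f : Lip) : Q f = L f - Lip.mean f • Lip.one := rfl
  have hQ_mean (f : Lip) : Lip.mean (Q f) = 0 := by
    rw [hQ_apply, map_sub, map_smul, hmean, Lip.mean_one, smul_eq_mul, mul_one, sub_self]
  have hQ_lip (f : Lip) : lipConst (Q f) ≤ θ * lipConst f := by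
    refine le_trans (le_of_eq ?_) (hL f)
    simp only [lipConst, hQ_apply, Lip.sub_apply, Lip.smul_apply, Lip.one_apply,
      sub_sub_sub_cancel_right]
  have hpow_lip (n : ℕ) (f : Lip) : lipConst ((Q ^ n) f) ≤ θ ^ n * lipConst f := by
    induction n with
    | zero => simp
    | succ n ih =>
      rw [pow_succ', mul_apply_eq_comp, pow_succ', mul_assoc]
      exact (hQ_lip _).trans (mul_le_mul_of_nonneg_left ih hθ)
  refine ContinuousLinearMap.opNorm_le_bound _ (by positivity) fun f => ?_
  rcases n with _ | n
  · simp only [pow_zero, one_apply_eq_self]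
    linarith [norm_nonneg f]
  · have hmean_pow : Lip.mean ((Q ^ (n + 1)) f) = 0 := by
      rw [pow_succ', mul_apply_eq_comp]
      exact hQ_mean _
    calc ‖(Q ^ (n + 1)) f‖ ≤ 2 * lipConst ((Q ^ (n + 1)) f) := Lip.norm_le_of_mean_eq_zero hmean_pow
      _ ≤ 2 * (θ ^ (n + 1) * lipConst f) := by gcongr; exact hpow_lip _ f
      _ ≤ 2 * θ ^ (n + 1) * ‖f‖ := by rw [← mul_assoc]; gcongr; exact f.lipConst_le_norm

/-- The factor by which the branches `v n` and `w n` together contract Lipschitz constants. -/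
noncomputable def pairRate (a : ℕ → ℝ) (n : ℕ) : ℝ := (12 + 16 * Real.pi * n ^ 4) * a n ^ 2

/-- The factor by which the transfer operator contracts Lipschitz constants. -/
noncomputable def contractionRate (a : ℕ → ℝ) (N : ℕ) : ℝ :=
  ∑' n : ℕ+, pairRate a n + (1 - leftEndJ a) ^ 2 / N

lemma pairRate_nonneg (a : ℕ → ℝ) (n : ℕ) : 0 ≤ pairRate a n := by
  unfold pairRate
  positivity

lemma contractionRate_nonneg (a : ℕ → ℝ) (N : ℕ) : 0 ≤ contractionRate a N :=
  add_nonneg (tsum_nonneg fun _ => pairRate_nonneg a _) (by positivity)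

lemma mul_add_mul_sub_mul_add_mul_of_add_eq_add {R : Type*} [CommRing R] {p q p' q' : R}
    (h : p + q = p' + q') (F G F' G' : R) :
    p * F + q * G - (p' * F' + q' * G') =
      p * (F - F') + q * (G - G') + (p - p') * (F' - G') := by
  linear_combination G' * h

lemma transfer_const_smul (T : I → I) (c : ℂ) (f : I → ℂ) :
    transfer T (c • f) = c • transfer T f := by
  funext x
  simp only [transfer, Pi.smul_apply, smul_eq_mul, mul_div_assoc, tsum_mul_left]

lemma IsWeight.abs_branchDeriv_v_sub_le {a : ℕ → ℝ} (ha : IsWeight a) (N : ℕ) (n : ℕ+) (x y : ℝ) :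
    |branchDeriv a N (.v n) x - branchDeriv a N (.v n) y| ≤
      4 * Real.pi * n ^ 4 * a n * dist x y := by
  have hpos := ha.pos n
  rw [branchDeriv_v, branchDeriv_v, ← mul_sub, add_sub_add_left_eq_sub, abs_mul, abs_of_pos hpos]
  calc a n * |Real.cos (4 * Real.pi * n ^ 4 * x) - Real.cos (4 * Real.pi * n ^ 4 * y)|
    _ ≤ a n * |4 * Real.pi * n ^ 4 * x - 4 * Real.pi * n ^ 4 * y| :=
      mul_le_mul_of_nonneg_left (Real.abs_cos_sub_cos_le _ _) hpos.le
    _ = 4 * Real.pi * n ^ 4 * a n * dist x y := by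
      rw [← mul_sub, abs_mul, abs_of_nonneg (by positivity), Real.dist_eq]
      ring

namespace IsWeight

variable {a : ℕ → ℝ} {N : ℕ} [NeZero N] (ha : IsWeight a)

lemma dist_branchMap_le {b : Branch N} {C : ℝ} (hC : ∀ t, branchDeriv a N b t ≤ C) (x y : I) :
    dist (ha.branchMap b x) (ha.branchMap b y) ≤ C * dist x y := by
  have h := convex_univ.norm_image_sub_le_of_norm_hasDerivWithin_le (x := (y : ℝ)) (y := (x : ℝ))
    (fun t _ => (hasDerivAt_branch a N b t).hasDerivWithinAt)
    (fun t _ => (Real.norm_of_nonneg (ha.branchDeriv_pos b t).le).trans_le (hC t))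
    (mem_univ _) (mem_univ _)
  simpa only [Subtype.dist_eq, dist_eq_norm, branchMap] using h

lemma dist_branchMap_v_branchMap_w_le (n : ℕ+) (y : I) :
    dist (ha.branchMap (N := N) (.v n) y) (ha.branchMap (N := N) (.w n) y) ≤ 4 * a n := by
  have hpiece := ha.piece_v_union_piece_w (N := N) n
  have hv := hpiece.subset (.inl ((ha.bijOn_branch (.v n)).mapsTo y.2))
  have hw := hpiece.subset (.inr ((ha.bijOn_branch (.w n)).mapsTo y.2))
  refine (Real.dist_le_of_mem_Icc (Ico_subset_Icc_self hv) (Ico_subset_Icc_self hw)).trans_eq ?_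
  rw [leftEnd_succ (show 1 ≤ (n : ℕ) from n.2), add_sub_cancel_left]

variable {f : I → ℂ} {K M : ℝ}

lemma norm_pair_sub_le (hK : 0 ≤ K) (hf : ∀ x y, ‖f x - f y‖ ≤ K * dist x y) (n : ℕ+) (x y : I) :
    ‖(branchDeriv a N (.v n) x : ℂ) * f (ha.branchMap (N := N) (.v n) x) +
        (branchDeriv a N (.w n) x : ℂ) * f (ha.branchMap (N := N) (.w n) x) -
      ((branchDeriv a N (.v n) y : ℂ) * f (ha.branchMap (N := N) (.v n) y) +
        (branchDeriv a N (.w n) y : ℂ) * f (ha.branchMap (N := N) (.w n) y))‖ ≤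
      pairRate a n * (K * dist x y) := by
  have hsum (t : ℝ) := branchDeriv_v_add_branchDeriv_w a N n t
  have hv : ‖f (ha.branchMap (N := N) (.v n) x) - f (ha.branchMap (N := N) (.v n) y)‖ ≤
      K * (3 * a n * dist x y) :=
    (hf _ _).trans (by gcongr; exact ha.dist_branchMap_le (ha.branchDeriv_v_le n) x y)
  have hw : ‖f (ha.branchMap (N := N) (.w n) x) - f (ha.branchMap (N := N) (.w n) y)‖ ≤
      K * (3 * a n * dist x y) :=
    (hf _ _).trans (by gcongr; exact ha.dist_branchMap_le (ha.branchDeriv_w_le n) x y)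
  have hvw : ‖f (ha.branchMap (N := N) (.v n) y) - f (ha.branchMap (N := N) (.w n) y)‖ ≤
      K * (4 * a n) :=
    (hf _ _).trans (by gcongr; exact ha.dist_branchMap_v_branchMap_w_le n y)
  have hp := (ha.branchDeriv_pos (N := N) (.v n) x).le
  have hq := (ha.branchDeriv_pos (N := N) (.w n) x).le
  have hpos := ha.pos n
  rw [mul_add_mul_sub_mul_add_mul_of_add_eq_add (by exact_mod_cast (hsum x).trans (hsum y).symm)]
  refine norm_add₃_le.trans ?_
  rw [norm_mul, norm_mul, norm_mul, Complex.norm_of_nonneg hp, Complex.norm_of_nonneg hq,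
    ← Complex.ofReal_sub, Complex.norm_real, Real.norm_eq_abs]
  calc _ ≤ branchDeriv a N (.v n) x * (K * (3 * a n * dist x y)) +
        branchDeriv a N (.w n) x * (K * (3 * a n * dist x y)) +
        4 * Real.pi * n ^ 4 * a n * dist x y * (K * (4 * a n)) := by
        gcongr
        exact ha.abs_branchDeriv_v_sub_le N n x y
    _ = (branchDeriv a N (.v n) x + branchDeriv a N (.w n) x) * (K * (3 * a n * dist x y)) +
        4 * Real.pi * n ^ 4 * a n * dist x y * (K * (4 * a n)) := by ring
    _ = pairRate a n * (K * dist x y) := by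
      rw [hsum, pairRate]
      ring

lemma norm_affine_sub_le (hK : 0 ≤ K) (hf : ∀ x y, ‖f x - f y‖ ≤ K * dist x y) (j : Fin N)
    (x y : I) :
    ‖(branchDeriv a N (.affine j) x : ℂ) * f (ha.branchMap (.affine j) x) -
      (branchDeriv a N (.affine j) y : ℂ) * f (ha.branchMap (.affine j) y)‖ ≤
      ((1 - leftEndJ a) / N) ^ 2 * (K * dist x y) := by
  have hpos := ha.length_pos (.affine j)
  simp only [branchDeriv, length, ← mul_sub, norm_mul] at hpos ⊢
  rw [Complex.norm_of_nonneg hpos.le]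
  calc _ ≤ (1 - leftEndJ a) / N * (K * ((1 - leftEndJ a) / N * dist x y)) := by
        gcongr
        refine (hf _ _).trans ?_
        gcongr
        exact ha.dist_branchMap_le (fun _ => le_rfl) x y
    _ = _ := by ring

lemma norm_branchDeriv_mul_le (hM : ∀ x, ‖f x‖ ≤ M) (b : Branch N) (x : I) :
    ‖(branchDeriv a N b x : ℂ) * f (ha.branchMap b x)‖ ≤ branchDeriv a N b x * M := by
  rw [norm_mul, Complex.norm_of_nonneg (ha.branchDeriv_pos b x).le]
  exact mul_le_mul_of_nonneg_left (hM _) (ha.branchDeriv_pos b x).le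

lemma summable_branchDeriv_mul (hM : ∀ x, ‖f x‖ ≤ M) (x : I) :
    Summable fun b : Branch N => (branchDeriv a N b x : ℂ) * f (ha.branchMap b x) :=
  .of_norm_bounded ((ha.hasSum_branchDeriv x).summable.mul_right M)
    fun b => ha.norm_branchDeriv_mul_le hM b x

include ha

lemma transfer_add {g : I → ℂ} {M' : ℝ} (hf : ∀ x, ‖f x‖ ≤ M) (hg : ∀ x, ‖g x‖ ≤ M') (x : I) :
    transfer (intervalMap a N) (f + g) x =
      transfer (intervalMap a N) f x + transfer (intervalMap a N) g x := by
  rw [ha.transfer_apply, ha.transfer_apply, ha.transfer_apply]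
  simp only [Pi.add_apply, mul_add]
  exact (ha.summable_branchDeriv_mul (N := N) hf x).tsum_add
    (ha.summable_branchDeriv_mul (N := N) hg x)

lemma norm_transfer_le (hM : ∀ x, ‖f x‖ ≤ M) (x : I) : ‖transfer (intervalMap a N) f x‖ ≤ M := by
  rw [ha.transfer_apply, ← one_mul M]
  exact tsum_of_norm_bounded ((ha.hasSum_branchDeriv (N := N) x).mul_right M)
    fun b => ha.norm_branchDeriv_mul_le hM b x

lemma norm_transfer_sub_le (hs : Summable fun n : ℕ+ => pairRate a n) (hK : 0 ≤ K)
    (hM : ∀ x, ‖f x‖ ≤ M) (hf : ∀ x y, ‖f x - f y‖ ≤ K * dist x y) (x y : I) :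
    ‖transfer (intervalMap a N) f x - transfer (intervalMap a N) f y‖ ≤
      contractionRate a N * (K * dist x y) := by
  have hx := ha.summable_branchDeriv_mul (N := N) hM x
  have hy := ha.summable_branchDeriv_mul (N := N) hM y
  have hN : (N : ℝ) ≠ 0 := NeZero.ne _
  rw [ha.transfer_apply, ha.transfer_apply, ← hx.tsum_sub hy, tsum_branch (hx.sub hy)]
  have hpairs := tsum_of_norm_bounded (hs.hasSum.mul_right (K * dist x y)) fun n =>
    ha.norm_pair_sub_le (N := N) hK hf n x y
  have haffine := norm_sum_le_of_le Finset.univ fun j _ =>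
    ha.norm_affine_sub_le (N := N) hK hf j x y
  simp only [add_sub_add_comm] at hpairs
  refine (norm_add_le_of_le hpairs haffine).trans_eq ?_
  rw [Finset.sum_const, Finset.card_univ, Fintype.card_fin, nsmul_eq_mul, contractionRate]
  field_simp

end IsWeight

/-- The transfer operator as a bounded operator on Lipschitz functions. -/
noncomputable def IsWeight.lipTransfer {a : ℕ → ℝ} (ha : IsWeight a)
    (hs : Summable fun n : ℕ+ => pairRate a n) (N : ℕ) [NeZero N] : Lip →L[ℂ] Lip :=
  LinearMap.mkContinuous
    { toFun f := Lip.ofBound (transfer (intervalMap a N) f)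
        ⟨contractionRate a N * lipConst f,
          mul_nonneg (contractionRate_nonneg a N) (lipConst_nonneg f)⟩ fun x y =>
        (ha.norm_transfer_sub_le hs (lipConst_nonneg f) f.norm_apply_le f.norm_sub_le x y).trans_eq
          (mul_assoc _ _ _).symm
      map_add' f g := Lip.ext (ha.transfer_add f.norm_apply_le g.norm_apply_le)
      map_smul' c f := Lip.ext (congrFun (transfer_const_smul _ c f)) }
    (1 + contractionRate a N) fun f => by
    have hrate := contractionRate_nonneg a N
    rw [one_add_mul]
    refine Lip.norm_le_add (by positivity) (ha.norm_transfer_le f.norm_apply_le) fun x y => ?_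
    refine (ha.norm_transfer_sub_le hs (lipConst_nonneg f) f.norm_apply_le f.norm_sub_le
      x y).trans ?_
    rw [mul_assoc]
    gcongr
    exact f.lipConst_le_norm

namespace IsWeight

variable {a : ℕ → ℝ} {N : ℕ} [NeZero N] (ha : IsWeight a)
  (hs : Summable fun n : ℕ+ => pairRate a n)

lemma lipTransfer_apply (f : Lip) (x : I) :
    ha.lipTransfer hs N f x = transfer (intervalMap a N) f x := rfl

lemma lipTransfer_one : ha.lipTransfer hs N Lip.one = Lip.one := by
  refine Lip.ext fun x => ?_
  simp only [ha.lipTransfer_apply, ha.transfer_apply, Lip.one_apply, mul_one]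
  exact (Complex.hasSum_ofReal.2 (ha.hasSum_branchDeriv x)).tsum_eq

lemma mean_lipTransfer (f : Lip) : Lip.mean (ha.lipTransfer hs N f) = Lip.mean f :=
  ha.integral_transfer f.integrable

lemma lipConst_lipTransfer_le (f : Lip) :
    lipConst (ha.lipTransfer hs N f) ≤ contractionRate a N * lipConst f := by
  refine lipConst_le (mul_nonneg (contractionRate_nonneg a N) (lipConst_nonneg f)) fun x y => ?_
  rw [mul_assoc]
  exact ha.norm_transfer_sub_le hs (lipConst_nonneg f) f.norm_apply_le f.norm_sub_le x y

lemma norm_lipTransfer_sub_mean_pow_le (n : ℕ) :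
    ‖(ha.lipTransfer hs N - Lip.mean.smulRight Lip.one) ^ n‖ ≤ 2 * contractionRate a N ^ n :=
  norm_pow_sub_mean_le (contractionRate_nonneg a N) (ha.mean_lipTransfer hs)
    (ha.lipConst_lipTransfer_le hs) n

end IsWeight

lemma natCast_mul_enorm_le_eVariationOn_cos (α β : ℂ) {m : ℕ} (hm : 2 ≤ m) :
    m * ‖β‖ₑ ≤ eVariationOn (fun x : ℝ => α + β * (Real.cos (m * Real.pi * x) : ℂ)) (Ico 0 1) := by
  have hm0 : (0 : ℝ) < m := by positivity
  have hjump (i : ℕ) : edist (α + β * (Real.cos (m * Real.pi * ((i + 1 : ℕ) / m)) : ℂ))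
      (α + β * (Real.cos (m * Real.pi * (i / m)) : ℂ)) = 2 * ‖β‖ₑ := by
    have hcos (k : ℕ) : Real.cos (m * Real.pi * (k / m)) = (-1) ^ k := by
      rw [← Real.cos_nat_mul_pi]
      congr 1
      field_simp
    have hdiff : β * ((-1 : ℝ) ^ (i + 1) : ℝ) - β * ((-1 : ℝ) ^ i : ℝ) = (-1) ^ i * (-2 * β) := by
      push_cast
      ring
    rw [edist_add_left, hcos, hcos, edist_eq_enorm_sub, hdiff, enorm_mul, enorm_mul,
      enorm_pow, enorm_neg, enorm_neg, enorm_one, one_pow, one_mul, ← ofReal_norm (2 : ℂ),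
      Complex.norm_ofNat, ENNReal.ofReal_ofNat]
  have hmono : MonotoneOn (fun i : ℕ => (i / m : ℝ)) (Iic (m - 1)) := fun i _ j _ hij => by
    dsimp only
    gcongr
  have hmem (i : ℕ) (hi : i ≤ m - 1) : (i / m : ℝ) ∈ Ico (0 : ℝ) 1 :=
    ⟨by positivity, (div_lt_one hm0).2 (by exact_mod_cast (by omega : i < m))⟩
  have hsum := eVariationOn.sum_le_of_monotoneOn_Iic
    (f := fun x : ℝ => α + β * (Real.cos (m * Real.pi * x) : ℂ)) hmono hmem
  simp only [hjump] at hsum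
  refine le_trans ?_ hsum
  rw [Finset.sum_const, Finset.card_range, nsmul_eq_mul, ← mul_assoc]
  gcongr
  exact_mod_cast (by omega : m ≤ (m - 1) * 2)

lemma transfer_iterate_const_smul (T : I → I) (k : ℕ) (c : ℂ) (f : I → ℂ) :
    (transfer T)^[k] (c • f) = c • (transfer T)^[k] f :=
  (show Function.Commute (transfer T) (c • ·) from transfer_const_smul T c).iterate_left k f

lemma IsWeight.le_essVariation_smul_branchDeriv_v {a : ℕ → ℝ} (ha : IsWeight a) (N : ℕ) (c : ℂ)
    (n : ℕ+) :
    ENNReal.ofReal (‖c‖ * (n ^ 4 * a n)) ≤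
      essVariation (c • fun x : I => (branchDeriv a N (.v n) x : ℂ)) := by
  have hcont : Continuous (c • fun x : I => (branchDeriv a N (.v n) x : ℂ)) :=
    (Complex.continuous_ofReal.comp
      ((continuous_branchDeriv a N (.v n)).comp continuous_subtype_val)).const_smul c
  have hcos (x : ℝ) : c * (branchDeriv a N (.v n) x : ℂ) =
      2 * c * a n + c * a n * (Real.cos ((4 * (n : ℕ) ^ 4 : ℕ) * Real.pi * x) : ℂ) := by
    rw [branchDeriv_v, show 4 * Real.pi * (n : ℝ) ^ 4 * x = (4 * (n : ℕ) ^ 4 : ℕ) * Real.pi * x by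
      push_cast; ring]
    push_cast
    ring
  have hvar := natCast_mul_enorm_le_eVariationOn_cos (2 * c * a n) (c * a n)
    (m := 4 * (n : ℕ) ^ 4) (by have := pow_pos n.pos 4; omega)
  rw [essVariation_eq_eVariationOn hcont]
  calc ENNReal.ofReal (‖c‖ * (n ^ 4 * a n))
    _ ≤ ENNReal.ofReal ((4 * (n : ℕ) ^ 4 : ℕ) * ‖c * a n‖) := by
      refine ENNReal.ofReal_le_ofReal ?_
      rw [norm_mul, Complex.norm_of_nonneg (ha.pos n).le]
      push_cast
      nlinarith [show 0 ≤ ‖c‖ * ((n : ℝ) ^ 4 * a n) by have := ha.pos n; positivity]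
    _ = (4 * (n : ℕ) ^ 4 : ℕ) * ‖c * a n‖ₑ := by
      rw [ENNReal.ofReal_mul (Nat.cast_nonneg _), ENNReal.ofReal_natCast, ofReal_norm]
    _ ≤ _ := hvar
    _ = eVariationOn (fun x : ℝ => c * (branchDeriv a N (.v n) x : ℂ)) (Subtype.val '' univ) := by
      rw [image_univ, Subtype.range_coe]
      simp only [hcos]
    _ = _ := (eVariationOn.comp_eq_of_monotoneOn _ _
      ((Subtype.mono_coe _).monotoneOn univ)).symm

namespace IsWeight

variable {a : ℕ → ℝ} {N : ℕ} [NeZero N] (ha : IsWeight a)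

lemma ordConnected_image_branchMap (b : Branch N) {S : Set I} (hS : S.OrdConnected) :
    (ha.branchMap b '' S).OrdConnected := by
  have hbij := ha.bijOn_branch b
  refine ⟨?_⟩
  rintro _ ⟨s, hs, rfl⟩ _ ⟨t, ht, rfl⟩ z ⟨hsz, hzt⟩
  have hz : (z : ℝ) ∈ piece a N b := ⟨(hbij.mapsTo s.2).1.trans hsz,
    lt_of_le_of_lt (show (z : ℝ) ≤ branch a N b t from hzt) (hbij.mapsTo t.2).2⟩
  obtain ⟨r, hr, hrz⟩ := hbij.surjOn hz
  obtain rfl : ha.branchMap b ⟨r, hr⟩ = z := Subtype.ext hrz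
  exact mem_image_of_mem _ (hS.out hs ht
    ⟨(ha.strictMono_branch b).le_iff_le.1 hsz, (ha.strictMono_branch b).le_iff_le.1 hzt⟩)

lemma transfer_indicator_image (b : Branch N) (S : Set I) :
    transfer (intervalMap a N) ((ha.branchMap b '' S).indicator fun _ => 1) =
      fun x : I => (branchDeriv a N b x : ℂ) * S.indicator (fun _ => 1) x := by
  funext x
  rw [ha.transfer_apply, tsum_eq_single b]
  · rw [indicator_image (ha.injective_branchMap b)]
    rfl
  · intro b' hb'
    rw [indicator_of_notMem, mul_zero]
    rintro ⟨y, -, hy⟩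
    exact disjoint_left.1 (ha.disjoint_range_branchMap hb') ⟨x, rfl⟩ ⟨y, hy⟩

/-- The image of the branch `v n` under the `k`-th iterate of the first affine branch: a set whose
indicator function is mapped by the `(k + 1)`-st power of the transfer operator to a multiple of
the derivative of `v n`. -/
def nestedPiece (N : ℕ) [NeZero N] (n : ℕ+) (k : ℕ) : Set I :=
  (ha.branchMap (N := N) (.affine 0) '' ·)^[k] (ha.branchMap (N := N) (.v n) '' univ)

lemma nestedPiece_succ (n : ℕ+) (k : ℕ) :
    ha.nestedPiece N n (k + 1) = ha.branchMap (N := N) (.affine 0) '' ha.nestedPiece N n k :=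
  iterate_succ_apply' _ _ _

lemma ordConnected_nestedPiece (n : ℕ+) (k : ℕ) : (ha.nestedPiece N n k).OrdConnected := by
  induction k with
  | zero => exact ha.ordConnected_image_branchMap _ ordConnected_univ
  | succ k ih =>
    rw [nestedPiece_succ]
    exact ha.ordConnected_image_branchMap _ ih

lemma iterate_transfer_indicator_nestedPiece (n : ℕ+) (k : ℕ) :
    (transfer (intervalMap a N))^[k + 1] ((ha.nestedPiece N n k).indicator fun _ => 1) =
      (length a N (.affine 0) : ℂ) ^ k • fun x : I => (branchDeriv a N (.v n) x : ℂ) := by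
  induction k with
  | zero =>
    rw [zero_add, iterate_one, pow_zero, one_smul]
    refine (ha.transfer_indicator_image (.v n) univ).trans ?_
    simp only [indicator_univ, mul_one]
  | succ k ih =>
    have haffine : transfer (intervalMap a N)
        ((ha.nestedPiece N n (k + 1)).indicator fun _ => 1) =
          (length a N (.affine 0) : ℂ) • (ha.nestedPiece N n k).indicator fun _ => 1 := by
      rw [nestedPiece_succ, ha.transfer_indicator_image]
      funext x
      rfl
    rw [iterate_succ_apply, haffine, transfer_iterate_const_smul, ih, smul_smul, pow_succ']

include ha

lemma not_actsContinuously {ν : (I → ℂ) → ℝ≥0∞}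
    (hν : ∀ S : Set I, S.OrdConnected → ν (S.indicator fun _ => 1) ≤ 3)
    (hvar : ∀ f, essVariation f ≤ ν f)
    (hunb : ¬ BddAbove (range fun n : ℕ+ => (n : ℝ) ^ 4 * a n)) {k : ℕ} (hk : 1 ≤ k) :
    ¬ ActsContinuously ν (transfer (intervalMap a N))^[k] := by
  rintro ⟨C, hC⟩
  obtain ⟨k, rfl⟩ := Nat.exists_eq_add_of_le' hk
  have hpos := ha.length_pos (N := N) (.affine 0)
  have hd : 0 < ‖(length a N (.affine 0) : ℂ) ^ k‖ := by
    rw [norm_pow, Complex.norm_of_nonneg hpos.le]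
    exact pow_pos hpos k
  refine hunb ⟨C * 3 / ‖(length a N (.affine 0) : ℂ) ^ k‖, ?_⟩
  rintro _ ⟨n, rfl⟩
  have hindicator := hν _ (ha.ordConnected_nestedPiece (N := N) n k)
  have hbound : ENNReal.ofReal (‖(length a N (.affine 0) : ℂ) ^ k‖ * (n ^ 4 * a n)) ≤
      ENNReal.ofReal (C * 3) :=
    calc _ ≤ _ := ha.le_essVariation_smul_branchDeriv_v N _ n
      _ ≤ _ := hvar _
      _ ≤ C * ν _ := by
        rw [← ha.iterate_transfer_indicator_nestedPiece]
        exact hC _ (hindicator.trans_lt (by norm_num))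
      _ ≤ C * 3 := by gcongr
      _ = _ := by
        rw [ENNReal.ofReal_mul (NNReal.coe_nonneg C), ENNReal.ofReal_coe_nnreal,
          ENNReal.ofReal_ofNat]
  rw [le_div_iff₀' hd]
  exact (ENNReal.ofReal_le_ofReal_iff (by positivity)).1 hbound

end IsWeight

section InverseSquare

lemma hasSum_one_div_pnat_sq : HasSum (fun n : ℕ+ => 1 / (n : ℝ) ^ 2) (Real.pi ^ 2 / 6) := by
  refine (PNat.coe_injective.hasSum_iff fun n hn => ?_).2 hasSum_zeta_two
  obtain rfl : n = 0 := by_contra fun h0 => hn ⟨⟨n, Nat.pos_of_ne_zero h0⟩, rfl⟩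
  simp

variable {f : ℕ+ → ℝ} {c : ℝ} (hf : ∀ n, 0 ≤ f n) (hle : ∀ n : ℕ+, f n ≤ c * (1 / n ^ 2))
include hf hle

lemma summable_of_le_mul_one_div_sq : Summable f :=
  .of_nonneg_of_le hf hle (hasSum_one_div_pnat_sq.summable.mul_left c)

lemma tsum_le_two_mul_of_le_mul_one_div_sq : ∑' n, f n ≤ 2 * c := by
  have hc : 0 ≤ c := by simpa using (hf 1).trans (hle 1)
  have hpi : Real.pi ^ 2 / 6 ≤ 2 := by nlinarith [Real.pi_lt_d2, Real.pi_pos]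
  calc ∑' n, f n ≤ c * (Real.pi ^ 2 / 6) :=
        hasSum_le hle (summable_of_le_mul_one_div_sq hf hle).hasSum
          (hasSum_one_div_pnat_sq.mul_left c)
    _ ≤ 2 * c := by nlinarith

end InverseSquare

section InverseCube

variable {a : ℕ → ℝ} (ha : ∀ n : ℕ, 1 ≤ n → a n = 1 / (100 * (n : ℝ) ^ 3))
include ha

lemma weight_pos (n : ℕ+) : 0 < a n := by
  rw [ha n n.2]
  positivity

lemma weight_le (n : ℕ+) : a n ≤ 1 / 100 * (1 / n ^ 2) := by
  have hn : (1 : ℝ) ≤ n := Nat.one_le_cast.2 n.2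
  rw [ha n n.2, div_mul_div_comm, one_mul]
  gcongr
  norm_num

lemma isWeight_of_eq : IsWeight a where
  pos := weight_pos ha
  summable := summable_of_le_mul_one_div_sq (fun n => (weight_pos ha n).le) (weight_le ha)
  leftEndJ_lt_one := by
    have hsum := tsum_le_two_mul_of_le_mul_one_div_sq (fun n => (weight_pos ha n).le) (weight_le ha)
    rw [leftEndJ]
    linarith

lemma pairRate_le (n : ℕ+) : pairRate a n ≤ 1 / 100 * (1 / n ^ 2) := by
  have hn : (1 : ℝ) ≤ (n : ℝ) ^ 4 := one_le_pow₀ (Nat.one_le_cast.2 n.2)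
  have hcoeff : 12 + 16 * Real.pi * (n : ℝ) ^ 4 ≤ 100 * (n : ℝ) ^ 4 := by
    nlinarith [Real.pi_lt_d2]
  calc pairRate a n ≤ 100 * (n : ℝ) ^ 4 * (1 / (100 * (n : ℝ) ^ 3)) ^ 2 := by
        rw [pairRate, ha n n.2]
        gcongr
    _ = 1 / 100 * (1 / n ^ 2) := by
        field_simp

lemma summable_pairRate : Summable fun n : ℕ+ => pairRate a n :=
  summable_of_le_mul_one_div_sq (fun n => pairRate_nonneg a n) (pairRate_le ha)

lemma contractionRate_le : contractionRate a 4 ≤ 3 / 4 := by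
  have hsum := tsum_le_two_mul_of_le_mul_one_div_sq (fun n => pairRate_nonneg a n) (pairRate_le ha)
  have hJ := (isWeight_of_eq ha).leftEndJ_pos
  have hJ' := (isWeight_of_eq ha).leftEndJ_lt_one
  rw [contractionRate]
  push_cast
  nlinarith

lemma ofReal_contractionRate_le : ENNReal.ofReal (contractionRate a 4) ≤ 3 / 4 := by
  refine (ENNReal.ofReal_le_ofReal (contractionRate_le ha)).trans_eq ?_
  rw [ENNReal.ofReal_div_of_pos (by norm_num), ENNReal.ofReal_ofNat, ENNReal.ofReal_ofNat]

lemma not_bddAbove_pow_mul_weight : ¬ BddAbove (range fun n : ℕ+ => (n : ℝ) ^ 4 * a n) := by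
  rintro ⟨C, hC⟩
  obtain ⟨n, hn⟩ := exists_nat_gt (100 * C)
  have hpow : (n + 1 : ℝ) ^ 4 * a (n + 1) = (n + 1) / 100 := by
    rw [ha _ n.succ_pos]
    push_cast
    field_simp
  have hle : ((n.succPNat : ℕ) : ℝ) ^ 4 * a n.succPNat ≤ C := hC ⟨n.succPNat, rfl⟩
  rw [Nat.succPNat_coe, Nat.succ_eq_add_one, Nat.cast_succ, hpow] at hle
  linarith

end InverseCube

end LipGap

theorem theorem1_general {a : ℕ → ℝ} (ha : IsWeight a) {N : ℕ} [NeZero N]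
    (hs : Summable fun n : ℕ+ => pairRate a n) {θ : ℝ≥0∞}
    (hθ : ENNReal.ofReal (contractionRate a N) ≤ θ) (hθ1 : θ < 1)
    (hunb : ¬ BddAbove (Set.range fun n : ℕ+ => (n : ℝ) ^ 4 * a n))
    (T : I → I) (hT : T = intervalMap a N) :
    (Pairwise fun b b' : Branch N => Disjoint (piece a N b) (piece a N b')) ∧
    (⋃ b : Branch N, piece a N b) = Set.Ico (0 : ℝ) 1 ∧
    (∀ b : Branch N, Set.BijOn (branch a N b) (Set.Ico (0 : ℝ) 1) (piece a N b)) ∧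
    (∀ (b : Branch N) (x : ℝ), HasDerivAt (branch a N b) (branchDeriv a N b x) x) ∧
    (∀ (b : Branch N) (x y : I), (y : ℝ) = branch a N b x → T y = x) ∧
    (∃ κ : ℝ, 1 < κ ∧ ∀ y : I, κ ≤ rightDeriv T y) ∧
    MeasurePreserving T volume volume ∧
    (∀ f : I → ℂ, Integrable f → Integrable (transfer T f) ∧
      ∀ g : I → ℂ, Measurable g → (∃ C : ℝ, ∀ x, ‖g x‖ ≤ C) →
        ∫ x, f x * g (T x) = ∫ x, transfer T f x * g x) ∧
    (∃ L : Lip →L[ℂ] Lip, (∀ (f : Lip) (x : I), L f x = transfer T f x) ∧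
      essSpectralRadius L ≤ θ ∧
      Module.End.HasEigenvalue (L : Lip →ₗ[ℂ] Lip) 1 ∧
      Module.finrank ℂ (Module.End.maxGenEigenspace (L : Lip →ₗ[ℂ] Lip) 1) = 1 ∧
      (∀ z : ℂ, Module.End.HasEigenvalue (L : Lip →ₗ[ℂ] Lip) z → ‖z‖ = 1 → z = 1) ∧
      ∃ r : ℝ, r < 1 ∧ ∀ z ∈ spectrum ℂ L, z = 1 ∨ ‖z‖ ≤ r) ∧
    (∀ k : ℕ, 1 ≤ k → ¬ ActsContinuously bvNorm (transfer T)^[k] ∧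
      ¬ ActsContinuously essBVNorm (transfer T)^[k]) := by
  subst hT
  obtain ⟨hess, hspec⟩ := spectralGap_of_norm_pow_le (contractionRate_nonneg a N)
    (ENNReal.ofReal_lt_one.1 (hθ.trans_lt hθ1)) Lip.mean_one (ha.lipTransfer_one hs)
    (ha.mean_lipTransfer hs) (ha.norm_lipTransfer_sub_mean_pow_le hs)
  exact ⟨ha.disjoint_piece, ha.iUnion_piece, ha.bijOn_branch, hasDerivAt_branch a N,
    fun _ _ _ h => ha.intervalMap_eq h, ha.exists_one_lt_le_rightDeriv,
    ha.measurePreserving_intervalMap,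
    fun _ hf => ⟨ha.integrable_transfer hf,
      fun _ hg ⟨_, hC⟩ => ha.integral_mul_comp_intervalMap hf hg hC⟩,
    ⟨ha.lipTransfer hs N, ha.lipTransfer_apply hs, hess.trans hθ, hspec⟩,
    fun _ hk => ⟨ha.not_actsContinuously (fun _ => bvNorm_indicator_le) essVariation_le_bvNorm
        hunb hk,
      ha.not_actsContinuously (fun _ => essBVNorm_indicator_le) essVariation_le_essBVNorm
        hunb hk⟩⟩

theorem theorem1 (a : ℕ → ℝ) (ha : ∀ n : ℕ, 1 ≤ n → a n = 1 / (100 * (n : ℝ) ^ 3))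
    (T : I → I) (hT : T = intervalMap a 4) :
    -- `T` is a uniformly expanding Markov map with full branches: the intervals `piece b`
    -- form a partition of `[0,1)`, each is the bijective image of `[0,1)` under an inverse branch
    -- of `T` with the prescribed derivative, and `T'` is bounded below by a constant `κ > 1`.
    (Pairwise fun b b' : Branch 4 => Disjoint (piece a 4 b) (piece a 4 b')) ∧
    (⋃ b : Branch 4, piece a 4 b) = Set.Ico (0 : ℝ) 1 ∧
    (∀ b : Branch 4, Set.BijOn (branch a 4 b) (Set.Ico (0 : ℝ) 1) (piece a 4 b)) ∧
    (∀ (b : Branch 4) (x : ℝ), HasDerivAt (branch a 4 b) (branchDeriv a 4 b x) x) ∧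
    (∀ (b : Branch 4) (x y : I), (y : ℝ) = branch a 4 b x → T y = x) ∧
    (∃ κ : ℝ, 1 < κ ∧ ∀ y : I, κ ≤ rightDeriv T y) ∧
    -- `T` preserves Lebesgue measure, and `transfer T` is its transfer operator.
    MeasurePreserving T volume volume ∧
    (∀ f : I → ℂ, Integrable f → Integrable (transfer T f) ∧
      ∀ g : I → ℂ, Measurable g → (∃ C : ℝ, ∀ x, ‖g x‖ ≤ C) →
        ∫ x, f x * g (T x) = ∫ x, transfer T f x * g x) ∧
    -- Spectral gap on Lipschitz functions.
    (∃ L : Lip →L[ℂ] Lip, (∀ (f : Lip) (x : I), L f x = transfer T f x) ∧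
      essSpectralRadius L ≤ 3 / 4 ∧
      Module.End.HasEigenvalue (L : Lip →ₗ[ℂ] Lip) 1 ∧
      Module.finrank ℂ (Module.End.maxGenEigenspace (L : Lip →ₗ[ℂ] Lip) 1) = 1 ∧
      (∀ z : ℂ, Module.End.HasEigenvalue (L : Lip →ₗ[ℂ] Lip) z → ‖z‖ = 1 → z = 1) ∧
      ∃ r : ℝ, r < 1 ∧ ∀ z ∈ spectrum ℂ L, z = 1 ∨ ‖z‖ ≤ r) ∧
    -- No power acts continuously on functions of bounded variation.
    (∀ k : ℕ, 1 ≤ k → ¬ ActsContinuously bvNorm (transfer T)^[k] ∧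
      ¬ ActsContinuously essBVNorm (transfer T)^[k]) := by
  exact theorem1_general (isWeight_of_eq ha) (summable_pairRate ha) (ofReal_contractionRate_le ha)
    (ENNReal.div_lt_of_lt_mul (by norm_num)) (not_bddAbove_pow_mul_weight ha) T hT
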